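/- Let $E=\{1,\dots,L\}$ be a finite set of items, let $\mathcal A$ be a family of subsets of $E$ with $|A|\le K$ for all $A\in\mathcal A$, let $\Phi\in\mathbb R^{L\times d}$ have rows $\phi_e^{T}$ with $\|\phi_e\|_2\le 1$ for all $e\in E$, and let $\lambda,\sigma>0$. Write $f(A,w)=\sum_{e\in A}w(e)$. Let $\mathtt{ORACLE}$ be a (possibly randomized, possibly only approximate) procedure that maps a weight vector $w\in\mathbb R^L$ to an element of $\mathcal A$; its internal randomness is drawn independently at each call. Coherent Gaussian case: $\theta^*\sim N(0,\lambda^2 I)$ in $\mathbb R^d$, $\bar w=\Phi\theta^*$, and in episode $t=1,\dots,n$ the weights are $w_t(e)=\bar w(e)+\eta_t(e)$, where the noises $\eta_t(e)$ are i.i.d. $N(0,\sigma^2)$, and those of episode $t$ are independent of everything drawn before. Let $A^*=\mathtt{ORACLE}(\bar w)$. The algorithm CombLinTS with parameters $(\Phi,\lambda,\sigma)$ starts from $\bar\theta_1=0$, $\Sigma_1=\lambda^2I$. In episode $t$ it samples $\theta_t\sim N(\bar\theta_t,\Sigma_t)$ (with fresh randomness), chooses $A^t=\mathtt{ORACLE}(\Phi\theta_t)$,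 observes $w_t(e)$ for $e\in A^t$, and obtains $(\bar\theta_{t+1},\Sigma_{t+1})$ from $(\bar\theta_t,\Sigma_t)$ by performing, successively for each $e\in A^t$, the Kalman step $$\bar\theta\leftarrow\Big[I-\frac{\Sigma\phi_e\phi_e^T}{\phi_e^T\Sigma\phi_e+\sigma^2}\Big]\bar\theta+\frac{\Sigma\phi_e}{\phi_e^T\Sigma\phi_e+\sigma^2}\,w_t(e),\qquad \Sigma\leftarrow\Sigma-\frac{\Sigma\phi_e\phi_e^T\Sigma}{\phi_e^T\Sigma\phi_e+\sigma^2}.$$ Then the realized regrets $R_t=f(A^*,w_t)-f(A^t,w_t)$ are integrable, and the Bayes regret $R_{\mathrm{Bayes}}(n)=\sum_{t=1}^n\mathbb E[R_t]$ satisfies $$R_{\mathrm{Bayes}}(n)\le 1+K\lambda\,\min\left\{\sqrt{\ln\frac{\lambda Ln}{\sqrt{2\pi}}},\ \sqrt{d\ln\frac{2dKn\lambda}{\sqrt{2\pi}}}\right\}\sqrt{\frac{2dn\,\ln\left(1+\frac{nK\lambda^2}{d\sigma^2}\right)}{\ln\left(1+\frac{\lambda^2}{\sigma^2}\right)}},$$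 where $\sqrt x$ is read as $0$ when $x<0$. -/

import Mathlib

open MeasureTheory ProbabilityTheory Matrix

namespace CombLinTS

noncomputable section

/-- `HasCondLaw P 𝓖 X κ`: the conditional law under `P` of the random variable `X`, given the
sub-σ-algebra `𝓖`, is the random measure `κ`. -/
def HasCondLaw {Ω α : Type*} [MeasurableSpace Ω] [MeasurableSpace α] (P : Measure Ω)
    (𝓖 : MeasurableSpace Ω) (X : Ω → α) (κ : Ω → Measure α) : Prop :=
  ∀ B : Set α, MeasurableSet B → P⟦X ⁻¹' B | 𝓖⟧ =ᵐ[P] fun ω => (κ ω).real B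

/-- The total weight `f(A, w) = ∑_{e ∈ A} w(e)` of a set of items. -/
def totalWeight {L : ℕ} (A : Finset (Fin L)) (w : Fin L → ℝ) : ℝ :=
  ∑ e ∈ A, w e

/-- The weight vector `Φ θ`. -/
def linWeight {L d : ℕ} (Φ : Matrix (Fin L) (Fin d) ℝ) (θ : EuclideanSpace ℝ (Fin d)) :
    Fin L → ℝ :=
  Φ *ᵥ θ.ofLp

/-- The feature vector of item `e`: the `e`-th row of `Φ`, with the Euclidean norm. -/
def feature {L d : ℕ} (Φ : Matrix (Fin L) (Fin d) ℝ) (e : Fin L) : EuclideanSpace ℝ (Fin d) :=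
  WithLp.toLp 2 (Φ e)

/-- Mean vector and covariance matrix maintained by the algorithm. -/
structure Belief (d : ℕ) where
  mean : Fin d → ℝ
  cov : Matrix (Fin d) (Fin d) ℝ

/-- The Kalman filtering step for one feature-observation pair `(φ, y)`, noise variance `σ²`. -/
def kalmanStep {d : ℕ} (σ : ℝ) (b : Belief d) (φ : Fin d → ℝ) (y : ℝ) : Belief d where
  mean := (1 - (φ ⬝ᵥ b.cov *ᵥ φ + σ ^ 2)⁻¹ • (b.cov * vecMulVec φ φ)) *ᵥ b.mean
    + y • (φ ⬝ᵥ b.cov *ᵥ φ + σ ^ 2)⁻¹ • (b.cov *ᵥ φ)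
  cov := b.cov - (φ ⬝ᵥ b.cov *ᵥ φ + σ ^ 2)⁻¹ • (b.cov * vecMulVec φ φ * b.cov)

/-- Kalman filtering over all items of `A` (in increasing order), after observing `w e`, `e ∈ A`. -/
def kalmanUpdate {L d : ℕ} (Φ : Matrix (Fin L) (Fin d) ℝ) (σ : ℝ) (b : Belief d)
    (A : Finset (Fin L)) (w : Fin L → ℝ) : Belief d :=
  A.sort.foldl (fun b e => kalmanStep σ b (Φ e) (w e)) b

/-- The belief held at the start of episode `t` (episodes are numbered `0, 1, 2, …`), when the
sets `A s` were chosen and the weights were `w s` in the episodes `s < t`. -/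
def belief {L d : ℕ} (Φ : Matrix (Fin L) (Fin d) ℝ) (lam σ : ℝ) (A : ℕ → Finset (Fin L))
    (w : ℕ → Fin L → ℝ) : ℕ → Belief d
  | 0 => ⟨0, lam ^ 2 • 1⟩
  | t + 1 => kalmanUpdate Φ σ (belief Φ lam σ A w t) (A t) (w t)

/-- A combinatorial optimization algorithm for the feasible family `𝒜`, possibly randomized and
possibly suboptimal: given a weight vector, it returns a random element of `𝒜`. -/
structure Oracle (L : ℕ) (𝒜 : Finset (Finset (Fin L))) where
  law : Kernel (Fin L → ℝ) (Finset (Fin L))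
  isMarkov : IsMarkovKernel law
  feasible : ∀ w, ∀ᵐ A ∂(law w), A ∈ 𝒜

/-- The random quantities of a run: the coefficient vector `θ*`, the benchmark set `A*`, and for
each episode `t` the sampled vector `θ_t`, the chosen set `A^t` and the weights `w_t`. -/
structure Run (Ω : Type*) (L d : ℕ) where
  thetaStar : Ω → EuclideanSpace ℝ (Fin d)
  optSet : Ω → Finset (Fin L)
  theta : ℕ → Ω → EuclideanSpace ℝ (Fin d)
  chosen : ℕ → Ω → Finset (Fin L)
  weight : ℕ → Ω → Fin L → ℝ

namespace Run

variable {Ω : Type*} {L d : ℕ}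

/-- The σ-algebra of everything drawn before episode `t`: `θ*`, `A*` and, for all `s < t`,
`θ_s`, `A^s`, `w_s`. -/
abbrev past (X : Run Ω L d) (t : ℕ) : MeasurableSpace Ω :=
  MeasurableSpace.comap X.thetaStar inferInstance ⊔ MeasurableSpace.comap X.optSet inferInstance ⊔
    ⨆ s : Fin t, (MeasurableSpace.comap (X.theta s) inferInstance ⊔
      MeasurableSpace.comap (X.chosen s) inferInstance ⊔
      MeasurableSpace.comap (X.weight s) inferInstance)

/-- The agent's belief `(θ̄_t, Σ_t)` at the start of episode `t`. -/
def beliefAt (X : Run Ω L d) (Φ : Matrix (Fin L) (Fin d) ℝ) (lam σ : ℝ) (t : ℕ) (ω : Ω) :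
    Belief d :=
  belief Φ lam σ (fun s => X.chosen s ω) (fun s => X.weight s ω) t

/-- The noise `η_t = w_t - Φ θ*` of episode `t`. -/
def noise (X : Run Ω L d) (Φ : Matrix (Fin L) (Fin d) ℝ) (t : ℕ) (ω : Ω) : Fin L → ℝ :=
  X.weight t ω - linWeight Φ (X.thetaStar ω)

/-- `X` is an `n`-episode run of CombLinTS with parameters `(Φ, λ, σ)` in the coherent Gaussian
case. The joint law is specified one draw at a time, each draw conditionally on all earlier ones. -/
structure IsCombLinTS [MeasurableSpace Ω] (P : Measure Ω) (Φ : Matrix (Fin L) (Fin d) ℝ)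
    (lam σ : ℝ) {𝒜 : Finset (Finset (Fin L))} (oracle : Oracle L 𝒜) (n : ℕ)
    (X : Run Ω L d) : Prop where
  measurable_thetaStar : Measurable X.thetaStar
  measurable_optSet : Measurable X.optSet
  measurable_theta : ∀ t < n, Measurable (X.theta t)
  measurable_chosen : ∀ t < n, Measurable (X.chosen t)
  measurable_weight : ∀ t < n, Measurable (X.weight t)
  /-- the prior on `θ*` is `N(0, λ² I)` -/
  prior : P.map X.thetaStar = multivariateGaussian 0 (lam ^ 2 • 1)
  /-- `A* = ORACLE(w̄)`, where `w̄ = Φ θ*` -/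
  optSet_law : HasCondLaw P (MeasurableSpace.comap X.thetaStar inferInstance) X.optSet
    fun ω => oracle.law (linWeight Φ (X.thetaStar ω))
  /-- `θ_t` is sampled from `N(θ̄_t, Σ_t)` -/
  theta_law : ∀ t < n, HasCondLaw P (X.past t) (X.theta t)
    fun ω => multivariateGaussian (WithLp.toLp 2 (X.beliefAt Φ lam σ t ω).mean)
      (X.beliefAt Φ lam σ t ω).cov
  /-- `A^t = ORACLE(Φ θ_t)` -/
  chosen_law : ∀ t < n, HasCondLaw P
    (X.past t ⊔ MeasurableSpace.comap (X.theta t) inferInstance) (X.chosen t)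
    fun ω => oracle.law (linWeight Φ (X.theta t ω))
  /-- the noises `η_t(e)` are i.i.d. `N(0, σ²)`, independent of everything drawn before -/
  noise_law : ∀ t < n, HasCondLaw P
    (X.past t ⊔ MeasurableSpace.comap (X.theta t) inferInstance ⊔
      MeasurableSpace.comap (X.chosen t) inferInstance) (X.noise Φ t)
    fun _ => Measure.pi fun _ : Fin L => gaussianReal 0 (σ ^ 2).toNNReal

/-- The realized regret `R_t = f(A*, w_t) - f(A^t, w_t)` in episode `t`. -/
def regret (X : Run Ω L d) (t : ℕ) (ω : Ω) : ℝ :=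
  totalWeight (X.optSet ω) (X.weight t ω) - totalWeight (X.chosen t ω) (X.weight t ω)

/-- The Bayes cumulative regret `∑_t E[R_t]` in `n` episodes. -/
def bayesRegret [MeasurableSpace Ω] (P : Measure Ω) (X : Run Ω L d) (n : ℕ) : ℝ :=
  ∑ t ∈ Finset.range n, ∫ ω, X.regret t ω ∂P

end Run

end

end CombLinTS

/-! Given the agent's belief `b_t`, the pair `(θ_t, A^t)` is drawn from the very law that `(θ*, A*)`
has given `b_t`. For `c ≥ 0` give item `e` the upper confidence bound `U_t(e) = φ_eᵀ θ̄_t + c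
s_t(e)`, where `s_t(e)` is the posterior standard deviation of its weight. Since `U_t` is a function
of `b_t`, its sums over `A*` and over `A^t` have equal expectations. Besides feasibility this is all
that is asked of the oracle, which is why it may be random and suboptimal. Adding and subtracting
these sums leaves in `E[R_t]` the overshoot of `φ_eᵀ θ*` above `U_t(e)` on `A*`, plus `c E ∑_{e ∈
A^t} s_t(e)`. The deviations `φ_eᵀ (θ* - θ̄_t)` summed over `A^t` have mean zero, because `A^t` and
`θ*` are independent given `b_t`; so do the noises, drawn after both sets (`integral_regret_le`).

Three facts feed this decomposition. Posterior: `lintegral_posterior` says that `(θ*, A*)` is a draw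
from the current belief. It rests on Bayes' rule for one Kalman step (`map_observe_eq_map_redraw`),
proved with characteristic functions. Conditional statements are phrased as identities between
integrals of arbitrary nonnegative test functions. Overshoot: `E (z - c)⁺` is at most the standard
normal density at `c`. Summing over all `L` items gives one bound (`lintegral_excess_le_card`),
controlling all directions at once by the norm of a Gaussian vector gives the other
(`lintegral_excess_le_dim`); they produce the two terms of the minimum. The level `c` is chosen so
that the overshoots of all `n` episodes add up to at most 1. Widths: along every feasible path `∑_t
∑_{e ∈ A^t} s_t(e)` is bounded by Cauchy-Schwarz and a log-determinant potential
(`sum_sqrt_quadForm_le`). -/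

namespace CombLinTS

/-! ### Information matrices and the log-determinant bound on the widths. -/

section LinearAlgebra

variable {L d : ℕ}

theorem posSemidef_vecMulVec_self (φ : Fin d → ℝ) : (vecMulVec φ φ).PosSemidef := by
  simpa using posSemidef_vecMulVec_self_star φ

theorem quadForm_nonneg {S : Matrix (Fin d) (Fin d) ℝ} (hS : S.PosDef) (φ : Fin d → ℝ) :
    0 ≤ φ ⬝ᵥ S *ᵥ φ := by
  simpa using hS.posSemidef.dotProduct_mulVec_nonneg φ

theorem det_add_smul_vecMulVec {M : Matrix (Fin d) (Fin d) ℝ} (hM : M.PosDef) (g : ℝ)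
    (φ : Fin d → ℝ) :
    (M + g • vecMulVec φ φ).det = M.det * (1 + g * (φ ⬝ᵥ M⁻¹ *ᵥ φ)) := by
  have hu : IsUnit M.det := hM.det_pos.ne'.isUnit
  have h := det_add_replicateCol_mul_replicateRow (ι := Unit) hu (g • φ) φ
  rw [← vecMulVec_eq] at h
  rw [← smul_vecMulVec, h]
  congr 1
  rw [det_unique]
  simp only [Matrix.add_apply, one_apply_eq]
  congr 1
  rw [Matrix.mul_assoc, Matrix.mul_apply]
  simp only [replicateRow_apply, dotProduct, Finset.mul_sum]
  refine Finset.sum_congr rfl fun i _ => ?_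
  rw [show (M⁻¹ * replicateCol Unit (g • φ)) i default = (M⁻¹ *ᵥ (g • φ)) i from rfl, mulVec_smul]
  simp only [Pi.smul_apply, smul_eq_mul]
  ring

/-- Sherman-Morrison: in information form a Kalman step only adds `σ⁻² φ φᵀ`, whatever the observed
value. -/
theorem kalmanStep_cov {σ : ℝ} (hσ : 0 < σ) {b : Belief d} (hb : b.cov.PosDef) (φ : Fin d → ℝ)
    (y : ℝ) : (kalmanStep σ b φ y).cov = (b.cov⁻¹ + (σ ^ 2)⁻¹ • vecMulVec φ φ)⁻¹ := by
  symm
  apply inv_eq_left_inv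
  have hu : IsUnit b.cov.det := hb.det_pos.ne'.isUnit
  have hs := quadForm_nonneg hb φ
  have hD : φ ⬝ᵥ b.cov *ᵥ φ + σ ^ 2 ≠ 0 := by positivity
  have hσ2 : σ ^ 2 ≠ 0 := by positivity
  have hmid : b.cov * vecMulVec φ φ * b.cov * vecMulVec φ φ =
      (φ ⬝ᵥ b.cov *ᵥ φ) • (b.cov * vecMulVec φ φ) := by
    rw [Matrix.mul_assoc, mul_vecMulVec, mul_vecMulVec, vecMulVec_mulVec, op_smul_eq_smul,
      smul_vecMulVec]
  -- The product to be computed is a combination of `1` and `X = Σ φ φᵀ`. The coefficient of `X` is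
  -- `σ⁻² - D⁻¹ - D⁻¹ σ⁻² s` with `s = φᵀ Σ φ` and `D = s + σ²`, which vanishes.
  have key : ∀ X : Matrix (Fin d) (Fin d) ℝ, (1 : Matrix (Fin d) (Fin d) ℝ) + (σ ^ 2)⁻¹ • X -
      ((φ ⬝ᵥ b.cov *ᵥ φ + σ ^ 2)⁻¹ • X +
        (φ ⬝ᵥ b.cov *ᵥ φ + σ ^ 2)⁻¹ • (σ ^ 2)⁻¹ • (φ ⬝ᵥ b.cov *ᵥ φ) • X) = 1 := by
    intro X
    rw [smul_smul, smul_smul, ← add_smul, add_sub_assoc, ← sub_smul]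
    convert add_zero _
    convert zero_smul ℝ X
    field_simp
    ring
  have e1 : b.cov * vecMulVec φ φ * b.cov * b.cov⁻¹ = b.cov * vecMulVec φ φ := by
    rw [Matrix.mul_assoc, Matrix.mul_nonsing_inv _ hu, Matrix.mul_one]
  rw [← key (b.cov * vecMulVec φ φ)]
  simp only [kalmanStep, Matrix.sub_mul, Matrix.mul_add, Matrix.mul_nonsing_inv _ hu,
    Matrix.smul_mul, Matrix.mul_smul, hmid, e1]
  module

theorem posDef_add_smul_vecMulVec {M : Matrix (Fin d) (Fin d) ℝ} (hM : M.PosDef) {g : ℝ}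
    (hg : 0 ≤ g) (φ : Fin d → ℝ) : (M + g • vecMulVec φ φ).PosDef :=
  hM.add_posSemidef ((posSemidef_vecMulVec_self φ).smul hg)

theorem posDef_kalmanStep_cov {σ : ℝ} (hσ : 0 < σ) {b : Belief d} (hb : b.cov.PosDef)
    (φ : Fin d → ℝ) (y : ℝ) : (kalmanStep σ b φ y).cov.PosDef := by
  rw [kalmanStep_cov hσ hb]
  exact (posDef_add_smul_vecMulVec hb.inv (by positivity) φ).inv

theorem kalmanStep_cov_inv {σ : ℝ} (hσ : 0 < σ) {b : Belief d} (hb : b.cov.PosDef)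
    (φ : Fin d → ℝ) (y : ℝ) :
    (kalmanStep σ b φ y).cov⁻¹ = b.cov⁻¹ + (σ ^ 2)⁻¹ • vecMulVec φ φ := by
  rw [kalmanStep_cov hσ hb, nonsing_inv_nonsing_inv]
  exact (posDef_add_smul_vecMulVec hb.inv (by positivity) φ).det_pos.ne'.isUnit

theorem posDef_foldl_kalmanStep_cov (Φ : Matrix (Fin L) (Fin d) ℝ) {σ : ℝ} (hσ : 0 < σ)
    (w : Fin L → ℝ) (l : List (Fin L)) {b : Belief d} (hb : b.cov.PosDef) :
    (l.foldl (fun b e => kalmanStep σ b (Φ e) (w e)) b).cov.PosDef := by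
  induction l generalizing b with
  | nil => exact hb
  | cons e l ih => exact ih (posDef_kalmanStep_cov hσ hb _ _)

theorem foldl_kalmanStep_cov_inv (Φ : Matrix (Fin L) (Fin d) ℝ) {σ : ℝ} (hσ : 0 < σ)
    (w : Fin L → ℝ) (l : List (Fin L)) {b : Belief d} (hb : b.cov.PosDef) :
    (l.foldl (fun b e => kalmanStep σ b (Φ e) (w e)) b).cov⁻¹ =
      b.cov⁻¹ + (l.map fun e => (σ ^ 2)⁻¹ • vecMulVec (Φ e) (Φ e)).sum := by
  induction l generalizing b with
  | nil => simp
  | cons e l ih =>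
    rw [List.foldl_cons, ih (posDef_kalmanStep_cov hσ hb _ _), kalmanStep_cov_inv hσ hb,
      List.map_cons, List.sum_cons, add_assoc]

/-- The information matrix `Λ_t = λ⁻² I + σ⁻² ∑_{s < t} ∑_{e ∈ A_s} φ_e φ_eᵀ`. -/
noncomputable def precision (Φ : Matrix (Fin L) (Fin d) ℝ) (lam σ : ℝ)
    (A : ℕ → Finset (Fin L)) (t : ℕ) : Matrix (Fin d) (Fin d) ℝ :=
  (lam ^ 2)⁻¹ • 1 + ∑ s ∈ Finset.range t, ∑ e ∈ A s, (σ ^ 2)⁻¹ • vecMulVec (Φ e) (Φ e)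

variable (Φ : Matrix (Fin L) (Fin d) ℝ) {lam σ : ℝ} (A : ℕ → Finset (Fin L))

theorem precision_succ (t : ℕ) : precision Φ lam σ A (t + 1) =
    precision Φ lam σ A t + ∑ e ∈ A t, (σ ^ 2)⁻¹ • vecMulVec (Φ e) (Φ e) := by
  rw [precision, Finset.sum_range_succ, ← add_assoc, precision]

theorem posSemidef_sum_smul_vecMulVec (B : Finset (Fin L)) :
    (∑ e ∈ B, (σ ^ 2)⁻¹ • vecMulVec (Φ e) (Φ e)).PosSemidef :=
  posSemidef_sum _ fun _ _ => (posSemidef_vecMulVec_self _).smul (by positivity)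

theorem posDef_precision (hlam : 0 < lam) (t : ℕ) : (precision Φ lam σ A t).PosDef :=
  (PosDef.one.smul (by positivity)).add_posSemidef
    (posSemidef_sum _ fun _ _ => posSemidef_sum_smul_vecMulVec Φ _)

theorem posDef_belief_cov (hlam : 0 < lam) (hσ : 0 < σ) (w : ℕ → Fin L → ℝ) (t : ℕ) :
    (belief Φ lam σ A w t).cov.PosDef := by
  induction t with
  | zero => exact PosDef.one.smul (by positivity)
  | succ t ih => exact posDef_foldl_kalmanStep_cov Φ hσ _ _ ih

theorem belief_cov_inv (hlam : 0 < lam) (hσ : 0 < σ) (w : ℕ → Fin L → ℝ) (t : ℕ) :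
    (belief Φ lam σ A w t).cov⁻¹ = precision Φ lam σ A t := by
  induction t with
  | zero =>
    simp only [belief, precision, Finset.range_zero, Finset.sum_empty, add_zero]
    exact inv_eq_left_inv (by simp [smul_smul, hlam.ne'])
  | succ t ih =>
    rw [precision_succ, ← ih, belief, kalmanUpdate,
      foldl_kalmanStep_cov_inv Φ hσ _ _ (posDef_belief_cov Φ A hlam hσ w t)]
    congr 1
    conv_rhs => rw [← Finset.sort_toFinset (A t) (· ≤ ·)]
    rw [List.sum_toFinset _ (Finset.sort_nodup _ _)]

theorem belief_cov (hlam : 0 < lam) (hσ : 0 < σ) (w : ℕ → Fin L → ℝ) (t : ℕ) :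
    (belief Φ lam σ A w t).cov = (precision Φ lam σ A t)⁻¹ := by
  rw [← belief_cov_inv Φ A hlam hσ w, nonsing_inv_nonsing_inv]
  exact (posDef_belief_cov Φ A hlam hσ w t).det_pos.ne'.isUnit

theorem norm_feature_sq (e : Fin L) : ‖feature Φ e‖ ^ 2 = Φ e ⬝ᵥ Φ e := by
  rw [EuclideanSpace.real_norm_sq_eq, dotProduct]
  simp [feature, sq]

/-- Since `Λ ≥ λ⁻² I`, variances never exceed the prior one. With `u = Λ⁻¹ φ` and `q = φᵀ u = uᵀ Λ
u`, one has `‖u‖² ≤ λ² q`, and Cauchy-Schwarz gives `q² ≤ ‖φ‖² ‖u‖² ≤ λ² q`. -/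
theorem quadForm_precision_inv_le (hlam : 0 < lam) (t : ℕ) {e : Fin L} (he : ‖feature Φ e‖ ≤ 1) :
    Φ e ⬝ᵥ (precision Φ lam σ A t)⁻¹ *ᵥ Φ e ≤ lam ^ 2 := by
  have hM := posDef_precision Φ (σ := σ) A hlam t
  set M := precision Φ lam σ A t with hMdef
  set u := M⁻¹ *ᵥ Φ e with hu
  have hMu : M *ᵥ u = Φ e := by
    rw [hu, mulVec_mulVec, mul_nonsing_inv _ hM.det_pos.ne'.isUnit, one_mulVec]
  have h1 : (lam ^ 2)⁻¹ * (u ⬝ᵥ u) ≤ Φ e ⬝ᵥ u := by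
    rw [dotProduct_comm (Φ e), ← hMu, hMdef, precision, add_mulVec, dotProduct_add, smul_mulVec,
      one_mulVec, dotProduct_smul, smul_eq_mul]
    have := (posSemidef_sum (Finset.range t) fun s _ =>
      posSemidef_sum_smul_vecMulVec Φ (σ := σ) (A s)).dotProduct_mulVec_nonneg u
    simp only [star_trivial] at this
    linarith
  have h2 : (Φ e ⬝ᵥ u) ^ 2 ≤ (Φ e ⬝ᵥ Φ e) * (u ⬝ᵥ u) := by
    have := Finset.sum_mul_sq_le_sq_mul_sq Finset.univ (Φ e) u
    simpa [dotProduct, sq] using this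
  have h3 : Φ e ⬝ᵥ Φ e ≤ 1 := by
    rw [← norm_feature_sq]
    exact pow_le_one₀ (norm_nonneg _) he
  have h4 : 0 ≤ u ⬝ᵥ u := by
    rw [dotProduct]; exact Finset.sum_nonneg fun i _ => mul_self_nonneg _
  have h5 : u ⬝ᵥ u ≤ lam ^ 2 * (Φ e ⬝ᵥ u) := by
    rwa [inv_mul_le_iff₀ (by positivity)] at h1
  by_contra! hlt
  have hq : 0 < Φ e ⬝ᵥ u := lt_trans (by positivity) hlt
  nlinarith

theorem det_le_det_add_posSemidef {M : Matrix (Fin d) (Fin d) ℝ} (hM : M.PosDef)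
    (B : Finset (Fin L)) :
    M.det ≤ (M + ∑ e ∈ B, (σ ^ 2)⁻¹ • vecMulVec (Φ e) (Φ e)).det := by
  induction B using Finset.induction_on with
  | empty => simp
  | insert e B he ih =>
    have hP := hM.add_posSemidef (posSemidef_sum_smul_vecMulVec Φ (σ := σ) B)
    rw [Finset.sum_insert he, add_comm (_ • _), ← add_assoc, det_add_smul_vecMulVec hP]
    refine ih.trans (le_mul_of_one_le_right hP.det_pos.le ?_)
    have := quadForm_nonneg hP.inv (Φ e)
    have : 0 ≤ (σ ^ 2)⁻¹ := by positivity
    nlinarith [mul_nonneg this (quadForm_nonneg hP.inv (Φ e))]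

/-- All widths of an episode use the covariance from its start, so the logarithms do not telescope
inside the episode. Instead each item alone accounts for at most the whole increase of `log det Λ`,
which costs the factor `K`. -/
theorem sum_log_one_add_le {K : ℕ} (hlam : 0 < lam) (t : ℕ) (hA : (A t).card ≤ K) :
    ∑ e ∈ A t, Real.log (1 + (σ ^ 2)⁻¹ * (Φ e ⬝ᵥ (precision Φ lam σ A t)⁻¹ *ᵥ Φ e)) ≤
      K * (Real.log (precision Φ lam σ A (t + 1)).det - Real.log (precision Φ lam σ A t).det) := by
  have hM := posDef_precision Φ (σ := σ) A hlam t
  have hM' := posDef_precision Φ (σ := σ) A hlam (t + 1)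
  have hmono : Real.log (precision Φ lam σ A t).det ≤ Real.log (precision Φ lam σ A (t + 1)).det :=
    Real.log_le_log hM.det_pos (by
      rw [precision_succ]; exact det_le_det_add_posSemidef Φ hM _)
  have hterm : ∀ e ∈ A t,
      Real.log (1 + (σ ^ 2)⁻¹ * (Φ e ⬝ᵥ (precision Φ lam σ A t)⁻¹ *ᵥ Φ e)) ≤
        Real.log (precision Φ lam σ A (t + 1)).det - Real.log (precision Φ lam σ A t).det := by
    intro e he
    have hq := quadForm_nonneg hM.inv (Φ e)
    have hpos : 0 < 1 + (σ ^ 2)⁻¹ * (Φ e ⬝ᵥ (precision Φ lam σ A t)⁻¹ *ᵥ Φ e) := by positivity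
    rw [le_sub_iff_add_le, add_comm, ← Real.log_mul hM.det_pos.ne' hpos.ne',
      ← det_add_smul_vecMulVec hM]
    have hP := posDef_add_smul_vecMulVec hM (g := (σ ^ 2)⁻¹) (by positivity) (Φ e)
    refine Real.log_le_log hP.det_pos ?_
    -- Add the item `e` first; the other items of the episode can only increase the determinant.
    rw [precision_succ, ← Finset.add_sum_erase _ _ he, ← add_assoc]
    exact det_le_det_add_posSemidef Φ hP _
  calc _ ≤ (A t).card • _ := Finset.sum_le_card_nsmul _ _ _ hterm
    _ ≤ _ := by
      rw [nsmul_eq_mul]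
      exact mul_le_mul_of_nonneg_right (by exact_mod_cast hA) (by linarith)

theorem trace_precision_le {K n : ℕ} (hΦ : ∀ e, ‖feature Φ e‖ ≤ 1)
    (hA : ∀ t < n, (A t).card ≤ K) :
    (precision Φ lam σ A n).trace ≤ (lam ^ 2)⁻¹ * d + n * K * (σ ^ 2)⁻¹ := by
  rw [precision, trace_add, trace_smul, trace_one, Fintype.card_fin, smul_eq_mul]
  gcongr
  rw [trace_sum, mul_assoc]
  calc _ ≤ (Finset.range n).card • ((K : ℝ) * (σ ^ 2)⁻¹) := ?_
    _ = _ := by simp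
  refine Finset.sum_le_card_nsmul _ _ _ fun s hs => ?_
  rw [trace_sum]
  calc _ ≤ (A s).card • (σ ^ 2)⁻¹ := ?_
    _ ≤ _ := by
      rw [nsmul_eq_mul]
      exact mul_le_mul_of_nonneg_right
        (by exact_mod_cast hA s (Finset.mem_range.1 hs)) (by positivity)
  refine Finset.sum_le_card_nsmul _ _ _ fun e _ => ?_
  rw [trace_smul, trace_vecMulVec, ← norm_feature_sq, smul_eq_mul]
  exact mul_le_of_le_one_right (by positivity) (pow_le_one₀ (norm_nonneg _) (hΦ e))

/-- The inequality of arithmetic and geometric means for the eigenvalues: `log μ ≤ log c + μ / c -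
1`, where `c = λ⁻² a` bounds the mean eigenvalue `trace / d`. -/
theorem log_det_precision_le {K n : ℕ} (hlam : 0 < lam) (hσ : 0 < σ)
    (hΦ : ∀ e, ‖feature Φ e‖ ≤ 1) (hA : ∀ t < n, (A t).card ≤ K) :
    Real.log (precision Φ lam σ A n).det ≤ Real.log (precision Φ lam σ A 0).det +
      d * Real.log (1 + n * K * lam ^ 2 / (d * σ ^ 2)) := by
  rcases Nat.eq_zero_or_pos d with rfl | hd
  · simp
  have hd' : (0 : ℝ) < d := by exact_mod_cast hd
  have hM := posDef_precision Φ (σ := σ) A hlam n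
  set a : ℝ := 1 + n * K * lam ^ 2 / (d * σ ^ 2) with ha
  have ha0 : 0 < a := by positivity
  have hl : 0 < (lam ^ 2)⁻¹ := by positivity
  have h0 : Real.log (precision Φ lam σ A 0).det = d * Real.log (lam ^ 2)⁻¹ := by
    simp [precision]
  have htr : (precision Φ lam σ A n).trace ≤ (lam ^ 2)⁻¹ * a * d := by
    refine (trace_precision_le Φ A hΦ hA).trans (le_of_eq ?_)
    rw [ha]; field_simp
  rw [h0, ← mul_add, ← Real.log_mul hl.ne' ha0.ne', hM.isHermitian.det_eq_prod_eigenvalues]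
  rw [hM.isHermitian.trace_eq_sum_eigenvalues] at htr
  simp only [RCLike.ofReal_real_eq_id, id_eq] at htr ⊢
  rw [Real.log_prod (fun i _ => (hM.eigenvalues_pos i).ne')]
  set c := (lam ^ 2)⁻¹ * a with hc
  have hc0 : 0 < c := by positivity
  calc _ ≤ ∑ i, (Real.log c + (hM.isHermitian.eigenvalues i / c - 1)) := by
        refine Finset.sum_le_sum fun i _ => ?_
        have hi := hM.eigenvalues_pos i
        have := Real.log_le_sub_one_of_pos (div_pos hi hc0)
        rw [Real.log_div hi.ne' hc0.ne'] at this
        linarith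
    _ = d * Real.log c + ((∑ i, hM.isHermitian.eigenvalues i) / c - d) := by
        simp [Finset.sum_add_distrib, Finset.sum_div]
    _ ≤ _ := by
        have : (∑ i, hM.isHermitian.eigenvalues i) / c ≤ d := by
          rw [div_le_iff₀ hc0]; linarith
        linarith

/-- By concavity `log (1 + x)` lies above its chord over `[0, m]`. -/
theorem le_div_log_mul_log {x m : ℝ} (hx : 0 ≤ x) (hxm : x ≤ m) (hm : 0 < m) :
    x ≤ m / Real.log (1 + m) * Real.log (1 + x) := by
  have hlog : 0 < Real.log (1 + m) := Real.log_pos (by linarith)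
  have hconc := strictConcaveOn_log_Ioi.concaveOn.2
    (Set.mem_Ioi.2 (show 0 < 1 + m by linarith)) (Set.mem_Ioi.2 one_pos)
    (show 0 ≤ x / m by positivity)
    (show 0 ≤ 1 - x / m by rw [sub_nonneg, div_le_one hm]; exact hxm) (by ring)
  simp only [smul_eq_mul, Real.log_one, mul_zero, add_zero, mul_one] at hconc
  rw [show x / m * (1 + m) + (1 - x / m) = 1 + x by field_simp; ring] at hconc
  calc x = m / Real.log (1 + m) * (x / m * Real.log (1 + m)) := by field_simp
    _ ≤ _ := by gcongr

theorem sum_quadForm_le {K n : ℕ} (hlam : 0 < lam) (hσ : 0 < σ)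
    (hΦ : ∀ e, ‖feature Φ e‖ ≤ 1) (hA : ∀ t < n, (A t).card ≤ K) :
    ∑ t ∈ Finset.range n, ∑ e ∈ A t, Φ e ⬝ᵥ (precision Φ lam σ A t)⁻¹ *ᵥ Φ e ≤
      lam ^ 2 * K * (d * Real.log (1 + n * K * lam ^ 2 / (d * σ ^ 2))) /
        Real.log (1 + lam ^ 2 / σ ^ 2) := by
  have hm : 0 < lam ^ 2 / σ ^ 2 := by positivity
  have hlog : 0 < Real.log (1 + lam ^ 2 / σ ^ 2) := Real.log_pos (by linarith)
  have hterm : ∀ t e, Φ e ⬝ᵥ (precision Φ lam σ A t)⁻¹ *ᵥ Φ e ≤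
      lam ^ 2 / Real.log (1 + lam ^ 2 / σ ^ 2) *
        Real.log (1 + (σ ^ 2)⁻¹ * (Φ e ⬝ᵥ (precision Φ lam σ A t)⁻¹ *ᵥ Φ e)) := by
    intro t e
    have hq := quadForm_nonneg (posDef_precision Φ (σ := σ) A hlam t).inv (Φ e)
    have hq' := quadForm_precision_inv_le Φ (σ := σ) A hlam t (hΦ e)
    -- The chord ends at `m = λ² / σ²`, the largest possible value of `σ⁻² φᵀ Λ⁻¹ φ`; this is the
    -- source of the denominator `log (1 + λ² / σ²)`.
    have := le_div_log_mul_log (x := (σ ^ 2)⁻¹ * (Φ e ⬝ᵥ (precision Φ lam σ A t)⁻¹ *ᵥ Φ e))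
      (m := lam ^ 2 / σ ^ 2) (by positivity) (by rw [div_eq_inv_mul]; gcongr) hm
    rw [inv_mul_le_iff₀ (by positivity)] at this
    refine this.trans (le_of_eq ?_)
    field_simp
  calc _ ≤ ∑ t ∈ Finset.range n, ∑ e ∈ A t, lam ^ 2 / Real.log (1 + lam ^ 2 / σ ^ 2) *
        Real.log (1 + (σ ^ 2)⁻¹ * (Φ e ⬝ᵥ (precision Φ lam σ A t)⁻¹ *ᵥ Φ e)) :=
        Finset.sum_le_sum fun t _ => Finset.sum_le_sum fun e _ => hterm t e
    _ ≤ ∑ t ∈ Finset.range n, lam ^ 2 / Real.log (1 + lam ^ 2 / σ ^ 2) * (K *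
        (Real.log (precision Φ lam σ A (t + 1)).det - Real.log (precision Φ lam σ A t).det)) := by
        refine Finset.sum_le_sum fun t ht => ?_
        rw [← Finset.mul_sum]
        exact mul_le_mul_of_nonneg_left
          (sum_log_one_add_le Φ A hlam t (hA t (Finset.mem_range.1 ht))) (by positivity)
    _ = lam ^ 2 / Real.log (1 + lam ^ 2 / σ ^ 2) * (K *
        (Real.log (precision Φ lam σ A n).det - Real.log (precision Φ lam σ A 0).det)) := by
        rw [← Finset.mul_sum, ← Finset.mul_sum,
          Finset.sum_range_sub (fun t => Real.log (precision Φ lam σ A t).det)]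
    _ ≤ lam ^ 2 / Real.log (1 + lam ^ 2 / σ ^ 2) * (K *
        (d * Real.log (1 + n * K * lam ^ 2 / (d * σ ^ 2)))) := by
        have := log_det_precision_le Φ A hlam hσ hΦ hA
        gcongr
        linarith
    _ = _ := by ring

/-- The sum of the posterior standard deviations of the chosen items along a run. -/
theorem sum_sqrt_quadForm_le {K n : ℕ} (hlam : 0 < lam) (hσ : 0 < σ)
    (hΦ : ∀ e, ‖feature Φ e‖ ≤ 1) (hA : ∀ t < n, (A t).card ≤ K) :
    ∑ t ∈ Finset.range n, ∑ e ∈ A t, √(Φ e ⬝ᵥ (precision Φ lam σ A t)⁻¹ *ᵥ Φ e) ≤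
      K * lam * √(d * n * Real.log (1 + n * K * lam ^ 2 / (d * σ ^ 2)) /
        Real.log (1 + lam ^ 2 / σ ^ 2)) := by
  rw [Finset.sum_sigma']
  set I := (Finset.range n).sigma fun t => A t
  have hcard : (I.card : ℝ) ≤ n * K := by
    rw [Finset.card_sigma]
    have : ∑ t ∈ Finset.range n, (A t).card ≤ (Finset.range n).card • K :=
      Finset.sum_le_card_nsmul _ _ _ fun t ht => hA t (Finset.mem_range.1 ht)
    rw [Finset.card_range, smul_eq_mul] at this
    exact_mod_cast this
  have hsum := sum_quadForm_le Φ A hlam hσ hΦ hA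
  rw [Finset.sum_sigma'] at hsum
  -- Cauchy-Schwarz over the at most `n K` pairs (episode, item). This `K` and the one in
  -- `sum_quadForm_le` combine to the factor `K` outside the root.
  have hcs := sq_sum_le_card_mul_sum_sq (s := I)
    (f := fun x => √(Φ x.2 ⬝ᵥ (precision Φ lam σ A x.1)⁻¹ *ᵥ Φ x.2))
  simp_rw [Real.sq_sqrt (quadForm_nonneg (posDef_precision Φ (σ := σ) A hlam _).inv _)] at hcs
  rw [← Real.sqrt_sq (show (0 : ℝ) ≤ K * lam by positivity), ← Real.sqrt_mul (by positivity)]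
  refine Real.le_sqrt_of_sq_le (hcs.trans ?_)
  calc _ ≤ (n * K : ℝ) * _ := mul_le_mul hcard hsum
        (Finset.sum_nonneg fun x _ =>
          quadForm_nonneg (posDef_precision Φ (σ := σ) A hlam _).inv _) (by positivity)
    _ = _ := by ring

end LinearAlgebra

/-! ### Measurability of the belief updates and the Gaussian kernel. -/

section BeliefMeasurable

variable {L d : ℕ} {α : Type*} [MeasurableSpace α]

instance instMeasurableSpaceBelief : MeasurableSpace (Belief d) :=
  MeasurableSpace.comap
    (fun b => ((b.mean, fun i j => b.cov i j) : (Fin d → ℝ) × (Fin d → Fin d → ℝ))) inferInstance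

theorem measurable_belief_mean : Measurable (fun b : Belief d => b.mean) :=
  measurable_fst.comp (comap_measurable _)

theorem measurable_belief_cov (i j : Fin d) : Measurable (fun b : Belief d => b.cov i j) :=
  have h : Measurable fun b : Belief d => fun i j => b.cov i j :=
    measurable_snd.comp (comap_measurable _)
  (measurable_pi_apply j).comp ((measurable_pi_apply i).comp h)

theorem measurable_belief_iff {f : α → Belief d} :
    Measurable f ↔
      (∀ i, Measurable fun a => (f a).mean i) ∧ ∀ i j, Measurable fun a => (f a).cov i j := by
  refine ⟨fun h => ⟨fun i => ((measurable_pi_apply i).comp measurable_belief_mean).comp h,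
    fun i j => (measurable_belief_cov i j).comp h⟩, fun h => ?_⟩
  rw [measurable_comap_iff]
  exact (measurable_pi_lambda _ h.1).prodMk
    (measurable_pi_lambda _ fun i => measurable_pi_lambda _ fun j => h.2 i j)

theorem measurable_kalmanStep (σ : ℝ) (φ : Fin d → ℝ) {f : α → Belief d} (hf : Measurable f)
    {y : α → ℝ} (hy : Measurable y) : Measurable fun a => kalmanStep σ (f a) φ (y a) := by
  obtain ⟨hm, hc⟩ := measurable_belief_iff.1 hf
  rw [measurable_belief_iff]
  constructor
  · intro i
    simp only [kalmanStep, Pi.add_apply, Pi.smul_apply, mulVec, dotProduct, Matrix.sub_apply,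
      Matrix.smul_apply, Matrix.mul_apply, smul_eq_mul]
    fun_prop
  · intro i j
    simp only [kalmanStep, mulVec, dotProduct, Matrix.sub_apply,
      Matrix.smul_apply, Matrix.mul_apply, smul_eq_mul]
    fun_prop

theorem measurable_foldl_kalmanStep (Φ : Matrix (Fin L) (Fin d) ℝ) (σ : ℝ) (l : List (Fin L))
    {f : α → Belief d} (hf : Measurable f) {w : α → Fin L → ℝ} (hw : Measurable w) :
    Measurable fun a => l.foldl (fun b e => kalmanStep σ b (Φ e) (w a e)) (f a) := by
  induction l generalizing f with
  | nil => exact hf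
  | cons e l ih =>
    exact ih (measurable_kalmanStep σ (Φ e) hf ((measurable_pi_apply e).comp hw))

theorem measurable_kalmanUpdate (Φ : Matrix (Fin L) (Fin d) ℝ) (σ : ℝ)
    {f : α → Belief d} (hf : Measurable f) {A : α → Finset (Fin L)} (hA : Measurable A)
    {w : α → Fin L → ℝ} (hw : Measurable w) :
    Measurable fun a => kalmanUpdate Φ σ (f a) (A a) (w a) := by
  have h : Measurable fun p : Finset (Fin L) × (Belief d × (Fin L → ℝ)) =>
      kalmanUpdate Φ σ p.2.1 p.1 p.2.2 :=
    -- There are finitely many sets, so each may be held fixed, and then the list of Kalman steps is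
    -- fixed too.
    measurable_from_prod_countable_right fun B =>
      measurable_foldl_kalmanStep Φ σ (B.sort (· ≤ ·)) measurable_fst measurable_snd
  exact h.comp (hA.prodMk (hf.prodMk hw))

open scoped MatrixOrder in
theorem isClosed_nonneg_matrix : IsClosed {S : Matrix (Fin d) (Fin d) ℝ | 0 ≤ S} := by
  have h : {S : Matrix (Fin d) (Fin d) ℝ | 0 ≤ S} = {S | Sᴴ = S} ∩
      ⋂ x : Fin d → ℝ, {S | 0 ≤ star x ⬝ᵥ S *ᵥ x} := by
    ext S
    simp [Matrix.nonneg_iff_posSemidef, posSemidef_iff_dotProduct_mulVec, IsHermitian]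
  rw [h]
  exact (isClosed_eq (by fun_prop) continuous_id).inter
    (isClosed_iInter fun x => isClosed_le continuous_const (by fun_prop))

-- The square root is continuous on the closed cone of positive semidefinite matrices and takes the
-- default value `0` off it, so it is measurable everywhere.
open scoped MatrixOrder Matrix.Norms.L2Operator in
theorem measurable_sqrt_belief_cov (i j : Fin d) :
    Measurable fun b : Belief d => CFC.sqrt b.cov i j := by
  let _ : MeasurableSpace (Matrix (Fin d) (Fin d) ℝ) :=
    inferInstanceAs (MeasurableSpace (Fin d → Fin d → ℝ))
  have _ : BorelSpace (Matrix (Fin d) (Fin d) ℝ) :=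
    inferInstanceAs (BorelSpace (Fin d → Fin d → ℝ))
  have hset : IsClosed {S : Matrix (Fin d) (Fin d) ℝ | 0 ≤ S} := isClosed_nonneg_matrix
  have hsqrt : Measurable (CFC.sqrt : Matrix (Fin d) (Fin d) ℝ → _) := by
    classical
    have h := (CFC.continuousOn_sqrt (A := Matrix (Fin d) (Fin d) ℝ)).measurable_piecewise
      (continuousOn_const (c := (0 : Matrix (Fin d) (Fin d) ℝ))) hset.measurableSet
    convert h using 1
    ext1 S
    by_cases hS : S ∈ {S : Matrix (Fin d) (Fin d) ℝ | 0 ≤ S}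
    · rw [Set.piecewise_eq_of_mem _ _ _ hS]
    · rw [Set.piecewise_eq_of_notMem _ _ _ hS, CFC.sqrt, cfcₙ_apply_of_not_predicate _ hS]
  have hcov : Measurable fun b : Belief d => b.cov :=
    measurable_pi_lambda _ fun i => measurable_pi_lambda _ fun j => measurable_belief_cov i j
  exact ((measurable_pi_apply j).comp (measurable_pi_apply i)).comp (hsqrt.comp hcov)

open scoped MatrixOrder in
/-- The Gaussian distribution described by a belief, as a Markov kernel. -/
noncomputable def gaussianKernel (d : ℕ) : Kernel (Belief d) (EuclideanSpace ℝ (Fin d)) where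
  toFun b := multivariateGaussian (WithLp.toLp 2 b.mean) b.cov
  measurable' := by
    refine Measure.measurable_of_measurable_coe _ fun s hs => ?_
    -- The sampling map `(b, z) ↦ m + √S z` is jointly measurable; the kernel pushes a fixed
    -- standard Gaussian `z` through it.
    have hf : Measurable fun p : Belief d × EuclideanSpace ℝ (Fin d) =>
        WithLp.toLp 2 p.1.mean + toEuclideanCLM (𝕜 := ℝ) (CFC.sqrt p.1.cov) p.2 := by
      refine (MeasurableEquiv.toLp 2 (Fin d → ℝ)).symm.measurableEmbedding.measurable_comp_iff.1 ?_
      refine measurable_pi_lambda _ fun i => ?_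
      simp only [Function.comp_apply, MeasurableEquiv.toLp_symm_apply, WithLp.ofLp_add,
        Pi.add_apply, ofLp_toEuclideanCLM, mulVec, dotProduct]
      have h1 := (measurable_pi_apply i).comp (measurable_belief_mean (d := d))
      have h2 := fun j => measurable_sqrt_belief_cov (d := d) i j
      refine (h1.comp measurable_fst).add (Finset.measurable_sum _ fun j _ => ?_)
      exact ((h2 j).comp measurable_fst).mul (by fun_prop)
    have : ∀ b : Belief d, multivariateGaussian (WithLp.toLp 2 b.mean) b.cov s =
        stdGaussian (EuclideanSpace ℝ (Fin d)) (Prod.mk b ⁻¹' ((fun p : Belief d ×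
          EuclideanSpace ℝ (Fin d) => WithLp.toLp 2 p.1.mean +
            toEuclideanCLM (𝕜 := ℝ) (CFC.sqrt p.1.cov) p.2) ⁻¹' s)) := by
      intro b
      exact Measure.map_apply (hf.comp measurable_prodMk_left) hs
    simp_rw [this]
    exact measurable_measure_prodMk_left (hf hs)

theorem gaussianKernel_apply (b : Belief d) :
    gaussianKernel d b = multivariateGaussian (WithLp.toLp 2 b.mean) b.cov := rfl

instance isMarkovKernel_gaussianKernel : IsMarkovKernel (gaussianKernel d) :=
  ⟨fun b => by rw [gaussianKernel_apply]; infer_instance⟩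

end BeliefMeasurable

/-! ### Expected Gaussian overshoots. -/

section GaussianTails

variable {d : ℕ}

theorem integral_Ioi_mul_exp_neg_sq_div_two {c : ℝ} (hc : 0 ≤ c) :
    IntegrableOn (fun z : ℝ => z * (Real.exp (-z ^ 2 / 2) / √(2 * Real.pi))) (Set.Ioi c) ∧
      ∫ z in Set.Ioi c, z * (Real.exp (-z ^ 2 / 2) / √(2 * Real.pi)) =
        Real.exp (-c ^ 2 / 2) / √(2 * Real.pi) := by
  have hderiv : ∀ z ∈ Set.Ici c, HasDerivAt
      (fun z : ℝ => -(Real.exp (-z ^ 2 / 2) / √(2 * Real.pi)))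
      (z * (Real.exp (-z ^ 2 / 2) / √(2 * Real.pi))) z := by
    intro z _
    have h1 : HasDerivAt (fun z : ℝ => -z ^ 2 / 2) (-z) z := by
      refine ((hasDerivAt_pow 2 z).neg.div_const 2).congr_deriv ?_
      simp only [Nat.cast_ofNat, Nat.add_one_sub_one, pow_one]
      ring
    refine (h1.exp.div_const √(2 * Real.pi)).neg.congr_deriv ?_
    ring
  have hpos : ∀ z ∈ Set.Ioi c, 0 ≤ z * (Real.exp (-z ^ 2 / 2) / √(2 * Real.pi)) := by
    intro z hz
    have : 0 ≤ z := hc.trans (le_of_lt hz)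
    positivity
  have hlim : Filter.Tendsto (fun z : ℝ => -(Real.exp (-z ^ 2 / 2) / √(2 * Real.pi)))
      Filter.atTop (nhds 0) := by
    have h1 : Filter.Tendsto (fun z : ℝ => -z ^ 2 / 2) Filter.atTop Filter.atBot := by
      have := (Filter.tendsto_pow_atTop (α := ℝ) two_ne_zero).atTop_div_const (two_pos)
      have := Filter.tendsto_neg_atTop_atBot.comp this
      refine this.congr fun z => ?_
      simp [neg_div]
    have := ((Real.tendsto_exp_atBot.comp h1).div_const √(2 * Real.pi)).neg
    simpa using this
  exact ⟨integrableOn_Ioi_deriv_of_nonneg' hderiv hpos hlim,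
    by rw [integral_Ioi_of_hasDerivAt_of_nonneg' hderiv hpos hlim]; ring⟩

/-- For `c ≥ 0`, `(z - c)⁺` is at most `z` on `z > c`, and `z` times the normal density is the
derivative of minus the density. -/
theorem lintegral_ofReal_sub_gaussianReal_le {c : ℝ} (hc : 0 ≤ c) :
    ∫⁻ z, ENNReal.ofReal (z - c) ∂gaussianReal 0 1 ≤
      ENNReal.ofReal (Real.exp (-c ^ 2 / 2) / √(2 * Real.pi)) := by
  obtain ⟨hint, hval⟩ := integral_Ioi_mul_exp_neg_sq_div_two hc
  rw [gaussianReal_of_var_ne_zero _ one_ne_zero,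
    lintegral_withDensity_eq_lintegral_mul _ (measurable_gaussianPDF 0 1) (by fun_prop), ← hval,
    ofReal_integral_eq_lintegral_ofReal hint, ← lintegral_indicator measurableSet_Ioi]
  · refine lintegral_mono fun z => ?_
    by_cases hz : z ∈ Set.Ioi c
    · rw [Set.indicator_of_mem hz, Pi.mul_apply, gaussianPDF, mul_comm,
        ← ENNReal.ofReal_mul (by linarith [Set.mem_Ioi.1 hz])]
      refine ENNReal.ofReal_le_ofReal ?_
      have : gaussianPDFReal 0 1 z = Real.exp (-z ^ 2 / 2) / √(2 * Real.pi) := by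
        simp [gaussianPDFReal, div_eq_inv_mul]
      rw [this]
      gcongr
      linarith
    · have : z - c ≤ 0 := by simpa using hz
      simp [ENNReal.ofReal_of_nonpos this]
  · refine (ae_restrict_iff' measurableSet_Ioi).2 (Filter.Eventually.of_forall fun z hz => ?_)
    have : 0 ≤ z := hc.trans (le_of_lt hz)
    simp only [Pi.zero_apply]
    positivity

theorem lintegral_ofReal_abs_sub_gaussianReal_le {c : ℝ} (hc : 0 ≤ c) :
    ∫⁻ z, ENNReal.ofReal (|z| - c) ∂gaussianReal 0 1 ≤
      ENNReal.ofReal (2 * (Real.exp (-c ^ 2 / 2) / √(2 * Real.pi))) := by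
  have hneg : ∫⁻ z, ENNReal.ofReal (-z - c) ∂gaussianReal 0 1 =
      ∫⁻ z, ENNReal.ofReal (z - c) ∂gaussianReal 0 1 := by
    have h : (gaussianReal 0 1).map (fun z : ℝ => -z) = gaussianReal 0 1 := by
      simp [gaussianReal_map_neg]
    conv_rhs => rw [← h]
    rw [lintegral_map (by fun_prop) (by fun_prop)]
  calc _ ≤ ∫⁻ z, (ENNReal.ofReal (z - c) + ENNReal.ofReal (-z - c)) ∂gaussianReal 0 1 := by
        refine lintegral_mono fun z => ?_
        rcases abs_cases z with ⟨h, _⟩ | ⟨h, _⟩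
        · rw [h]; exact le_self_add
        · rw [h]; exact le_add_self
    _ = _ + _ := by rw [lintegral_add_left (by fun_prop), hneg]
    _ ≤ _ := add_le_add (lintegral_ofReal_sub_gaussianReal_le hc)
        (lintegral_ofReal_sub_gaussianReal_le hc)
    _ = _ := by rw [← ENNReal.ofReal_add (by positivity) (by positivity), ← two_mul]

theorem map_inner_stdGaussian {E : Type*} [NormedAddCommGroup E] [InnerProductSpace ℝ E]
    [FiniteDimensional ℝ E] [MeasurableSpace E] [BorelSpace E] (v : E) :
    (stdGaussian E).map (fun z => inner ℝ v z) = (gaussianReal 0 1).map (fun z => ‖v‖ * z) := by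
  have h1 : (stdGaussian E).map (innerSL ℝ v) = gaussianReal 0 (‖v‖ ^ 2).toNNReal := by
    rw [IsGaussian.map_eq_gaussianReal, integral_strongDual_stdGaussian, variance_dual_stdGaussian,
      innerSL_apply_norm]
  rw [gaussianReal_map_const_mul]
  refine h1.trans ?_
  congr 1
  · simp
  · ext; simp

/-- `‖z‖₂ - c` is dominated by the sum of the coordinate excesses `(|z_i| - c / √d)⁺`. -/
theorem norm_sub_le_sum_posPart {c : ℝ} (hc : 0 ≤ c) (z : EuclideanSpace ℝ (Fin d)) :
    ‖z‖ - c ≤ ∑ i, max (|z i| - c / √d) 0 := by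
  set a := c / √d with ha
  have ha0 : 0 ≤ a := by positivity
  -- `u` is `z` clipped to the cube `[-a, a]^d`, which lies in the ball of radius `a √d = c`.
  let u : EuclideanSpace ℝ (Fin d) := WithLp.toLp 2 fun i => max (-a) (min a (z i))
  have hu : ‖u‖ ≤ c := by
    rw [EuclideanSpace.norm_eq]
    refine Real.sqrt_le_iff.2 ⟨hc, ?_⟩
    rcases Nat.eq_zero_or_pos d with rfl | hd
    · simp; positivity
    have hd' : (0 : ℝ) < d := by exact_mod_cast hd
    calc ∑ i, ‖u i‖ ^ 2 ≤ ∑ _i : Fin d, a ^ 2 := by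
          refine Finset.sum_le_sum fun i _ => ?_
          refine pow_le_pow_left₀ (norm_nonneg _) ?_ 2
          rw [Real.norm_eq_abs]
          exact abs_le.2 ⟨le_max_left _ _, max_le (by linarith) (min_le_left _ _)⟩
      _ = c ^ 2 := by
          rw [Finset.sum_const, Finset.card_univ, Fintype.card_fin, nsmul_eq_mul, ha, div_pow,
            Real.sq_sqrt hd'.le]
          field_simp
  have hz : ‖z - u‖ ≤ ∑ i, max (|z i| - a) 0 := by
    have hsum : z - u = ∑ i, (z i - u i) • EuclideanSpace.basisFun (Fin d) ℝ i := by
      have := (EuclideanSpace.basisFun (Fin d) ℝ).sum_repr (z - u)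
      simpa using this.symm
    rw [hsum]
    refine (norm_sum_le _ _).trans (Finset.sum_le_sum fun i _ => ?_)
    rw [norm_smul, OrthonormalBasis.norm_eq_one, mul_one, Real.norm_eq_abs]
    change |z i - max (-a) (min a (z i))| ≤ _
    rcases le_total a (z i) with h1 | h1
    · rw [min_eq_left h1, max_eq_right (by linarith), abs_of_nonneg (by linarith),
        abs_of_nonneg (by linarith)]
      exact le_max_left _ _
    · rcases le_total (-a) (z i) with h2 | h2
      · rw [min_eq_right h1, max_eq_right h2]
        simp
      · rw [min_eq_right h1, max_eq_left h2, abs_of_nonpos (by linarith),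
          abs_of_nonpos (by linarith)]
        exact le_max_of_le_left (by linarith)
  have := norm_add_le (z - u) u
  rw [sub_add_cancel] at this
  linarith

theorem lintegral_ofReal_norm_sub_stdGaussian_le {c : ℝ} (hc : 0 ≤ c) :
    ∫⁻ z, ENNReal.ofReal (‖z‖ - c) ∂stdGaussian (EuclideanSpace ℝ (Fin d)) ≤
      ENNReal.ofReal (2 * d * (Real.exp (-c ^ 2 / (2 * d)) / √(2 * Real.pi))) := by
  calc _ ≤ ∫⁻ z : EuclideanSpace ℝ (Fin d), ∑ i, ENNReal.ofReal (|z i| - c / √d)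
        ∂stdGaussian (EuclideanSpace ℝ (Fin d)) := by
        refine lintegral_mono fun z => ?_
        refine (ENNReal.ofReal_le_ofReal (norm_sub_le_sum_posPart hc z)).trans ?_
        rw [ENNReal.ofReal_sum_of_nonneg fun i _ => le_max_right _ _]
        simp
    _ = ∑ i : Fin d, ∫⁻ x, ENNReal.ofReal (|x| - c / √d) ∂gaussianReal 0 1 := by
        rw [lintegral_finsetSum _ (by fun_prop)]
        refine Finset.sum_congr rfl fun i _ => ?_
        have h := measurePreserving_eval_multivariateGaussian (ι := Fin d) (μ := 0)
          (S := 1) PosSemidef.one (i := i)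
        simp only [multivariateGaussian_zero_one, PiLp.zero_apply, one_apply_eq,
          Real.toNNReal_one] at h
        rw [← h.map_eq, lintegral_map (by fun_prop) h.measurable]
    _ ≤ ∑ i : Fin d, ENNReal.ofReal (2 * (Real.exp (-(c / √d) ^ 2 / 2) / √(2 * Real.pi))) :=
        Finset.sum_le_sum fun i _ => lintegral_ofReal_abs_sub_gaussianReal_le (by positivity)
    _ = _ := by
        rw [← ENNReal.ofReal_sum_of_nonneg fun i _ => by positivity]
        rw [Finset.sum_const, Finset.card_univ, Fintype.card_fin, nsmul_eq_mul, div_pow,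
          Real.sq_sqrt (Nat.cast_nonneg d)]
        congr 1
        rw [show -(c ^ 2 / (d : ℝ)) / 2 = -c ^ 2 / (2 * d) by ring]
        ring

open scoped MatrixOrder in
theorem lintegral_gaussianKernel (b : Belief d) {g : EuclideanSpace ℝ (Fin d) → ENNReal}
    (hg : Measurable g) :
    ∫⁻ θ, g θ ∂gaussianKernel d b = ∫⁻ z, g (WithLp.toLp 2 b.mean +
      toEuclideanCLM (𝕜 := ℝ) (CFC.sqrt b.cov) z) ∂stdGaussian (EuclideanSpace ℝ (Fin d)) := by
  rw [gaussianKernel_apply, multivariateGaussian, lintegral_map hg (by fun_prop)]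

open scoped MatrixOrder in
theorem dotProduct_sqrt_mulVec {S : Matrix (Fin d) (Fin d) ℝ} (φ : Fin d → ℝ)
    (z : EuclideanSpace ℝ (Fin d)) :
    φ ⬝ᵥ (toEuclideanCLM (𝕜 := ℝ) (CFC.sqrt S) z).ofLp =
      inner ℝ (toEuclideanCLM (𝕜 := ℝ) (CFC.sqrt S) (WithLp.toLp 2 φ)) z := by
  have h : IsSelfAdjoint (toEuclideanCLM (𝕜 := ℝ) (CFC.sqrt S)) :=
    (CFC.sqrt_nonneg S).isSelfAdjoint.map _
  rw [← h.adjoint_eq, ContinuousLinearMap.adjoint_inner_left, h.adjoint_eq,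
    EuclideanSpace.inner_eq_star_dotProduct]
  simp [dotProduct_comm]

open scoped MatrixOrder in
theorem norm_sqrt_mulVec {S : Matrix (Fin d) (Fin d) ℝ} (hS : S.PosSemidef) (φ : Fin d → ℝ) :
    ‖toEuclideanCLM (𝕜 := ℝ) (CFC.sqrt S) (WithLp.toLp 2 φ)‖ = √(φ ⬝ᵥ S *ᵥ φ) := by
  rw [norm_eq_sqrt_real_inner, ← dotProduct_sqrt_mulVec, ← ContinuousLinearMap.comp_apply,
    ← ContinuousLinearMap.mul_def, ← map_mul, CFC.sqrt_mul_sqrt_self _ hS.nonneg]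
  simp

open scoped MatrixOrder in
/-- Under the posterior, a linear functional exceeds `c` standard deviations by little. -/
theorem lintegral_ofReal_dotProduct_sub_le {b : Belief d} (hb : b.cov.PosDef) (φ : Fin d → ℝ)
    {c : ℝ} (hc : 0 ≤ c) :
    ∫⁻ θ, ENNReal.ofReal (φ ⬝ᵥ (θ.ofLp - b.mean) - c * √(φ ⬝ᵥ b.cov *ᵥ φ)) ∂gaussianKernel d b ≤
      ENNReal.ofReal (√(φ ⬝ᵥ b.cov *ᵥ φ) * (Real.exp (-c ^ 2 / 2) / √(2 * Real.pi))) := by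
  rw [lintegral_gaussianKernel _ (by fun_prop)]
  simp only [WithLp.ofLp_add, add_sub_cancel_left, dotProduct_sqrt_mulVec]
  have h := map_inner_stdGaussian (toEuclideanCLM (𝕜 := ℝ) (CFC.sqrt b.cov) (WithLp.toLp 2 φ))
  rw [norm_sqrt_mulVec hb.posSemidef] at h
  set s := √(φ ⬝ᵥ b.cov *ᵥ φ)
  rw [← lintegral_map (μ := stdGaussian (EuclideanSpace ℝ (Fin d)))
    (f := fun x => ENNReal.ofReal (x - c * s)) (by fun_prop) (by fun_prop), h,
    lintegral_map (by fun_prop) (by fun_prop)]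
  have hs : 0 ≤ s := Real.sqrt_nonneg _
  simp_rw [show ∀ z, s * z - c * s = s * (z - c) by intro z; ring, ENNReal.ofReal_mul hs]
  rw [lintegral_const_mul _ (by fun_prop)]
  gcongr
  exact lintegral_ofReal_sub_gaussianReal_le hc

open scoped MatrixOrder in
/-- The posterior excess of all linear functionals at once over `c` standard deviations. -/
theorem lintegral_gaussianKernel_le_of_forall {b : Belief d} (hb : b.cov.PosDef)
    {g : EuclideanSpace ℝ (Fin d) → ENNReal} (hg : Measurable g) {M c : ℝ} (hM : 0 ≤ M)
    (hc : 0 ≤ c) (h : ∀ θ r, (∀ φ : Fin d → ℝ,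
      φ ⬝ᵥ (θ.ofLp - b.mean) ≤ √(φ ⬝ᵥ b.cov *ᵥ φ) * r) → g θ ≤ ENNReal.ofReal (M * (r - c))) :
    ∫⁻ θ, g θ ∂gaussianKernel d b ≤
      ENNReal.ofReal (M * (2 * d * (Real.exp (-c ^ 2 / (2 * d)) / √(2 * Real.pi)))) := by
  rw [lintegral_gaussianKernel _ hg, ENNReal.ofReal_mul hM]
  refine le_trans ?_ (mul_le_mul_right (lintegral_ofReal_norm_sub_stdGaussian_le hc) _)
  rw [← lintegral_const_mul _ (by fun_prop)]
  refine lintegral_mono fun z => ?_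
  rw [← ENNReal.ofReal_mul hM]
  -- Here `r = ‖z‖`: Cauchy-Schwarz applied to `φᵀ √S z = ⟨√S φ, z⟩`, where `‖√S φ‖` is the standard
  -- deviation.
  refine h _ _ fun φ => ?_
  simp only [WithLp.ofLp_add, add_sub_cancel_left, dotProduct_sqrt_mulVec]
  rw [← norm_sqrt_mulVec hb.posSemidef]
  exact real_inner_le_norm _ _

end GaussianTails

/-! ### Bayes' rule for one observation. -/

section KalmanStep

variable {L d : ℕ}

theorem charFun_gaussianKernel {b : Belief d} (hb : b.cov.PosDef) (u : Fin d → ℝ) :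
    charFun (gaussianKernel d b) (WithLp.toLp 2 u) =
      Complex.exp ((u ⬝ᵥ b.mean : ℝ) * Complex.I - (u ⬝ᵥ b.cov *ᵥ u : ℝ) / 2) := by
  rw [gaussianKernel_apply, charFun_multivariateGaussian hb.posSemidef]
  congr 3
  rw [EuclideanSpace.inner_eq_star_dotProduct]
  simp [dotProduct_comm]

theorem charFun_gaussianReal_zero {σ : ℝ} (v : ℝ) :
    charFun (gaussianReal 0 (σ ^ 2).toNNReal) v = Complex.exp (-(v ^ 2 * σ ^ 2 : ℝ) / 2) := by
  rw [charFun_gaussianReal]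
  congr 1
  rw [Real.coe_toNNReal _ (sq_nonneg σ)]
  push_cast
  ring

theorem exists_dual_prod (Λ : StrongDual ℝ (EuclideanSpace ℝ (Fin d) × ℝ)) :
    ∃ (u : Fin d → ℝ) (v : ℝ), ∀ x y, Λ (x, y) = u ⬝ᵥ x.ofLp + v * y := by
  refine ⟨fun i => Λ (EuclideanSpace.basisFun (Fin d) ℝ i, 0), Λ (0, 1), fun x y => ?_⟩
  have hx : (x, y) = ∑ i, x i • ((EuclideanSpace.basisFun (Fin d) ℝ i, (0 : ℝ))) + y • (0, 1) := by
    ext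
    · simp [Prod.fst_sum, Finset.sum_apply, Pi.single_apply]
    · simp [Prod.snd_sum]
  rw [hx, map_add, map_sum]
  simp only [map_smul, smul_eq_mul, dotProduct, mul_comm]

/-- The characteristic function of the joint law of `(θ, y)`, where `y = φᵀ θ + ε`. -/
theorem charFunDual_map_observe {b : Belief d} (hb : b.cov.PosDef) (φ : Fin d → ℝ) (σ : ℝ)
    (u : Fin d → ℝ) (v : ℝ) :
    ∫ p, Complex.exp (((u ⬝ᵥ p.1.ofLp + v * (φ ⬝ᵥ p.1.ofLp + p.2) : ℝ) : ℂ) * Complex.I)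
      ∂((gaussianKernel d b).prod (gaussianReal 0 (σ ^ 2).toNNReal)) =
    Complex.exp ((u ⬝ᵥ b.mean + v * (φ ⬝ᵥ b.mean) : ℝ) * Complex.I -
      (u ⬝ᵥ b.cov *ᵥ u + 2 * v * (u ⬝ᵥ b.cov *ᵥ φ) +
        v ^ 2 * (φ ⬝ᵥ b.cov *ᵥ φ + σ ^ 2) : ℝ) / 2) := by
  have hsymm : φ ⬝ᵥ b.cov *ᵥ u = u ⬝ᵥ b.cov *ᵥ φ := by
    rw [dotProduct_mulVec, ← mulVec_transpose, dotProduct_comm]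
    congr 2
    exact (conjTranspose_eq_transpose_of_trivial b.cov).symm.trans hb.isHermitian
  have hsplit : ∀ p : EuclideanSpace ℝ (Fin d) × ℝ,
      Complex.exp (((u ⬝ᵥ p.1.ofLp + v * (φ ⬝ᵥ p.1.ofLp + p.2) : ℝ) : ℂ) * Complex.I) =
        Complex.exp ((inner ℝ p.1 (WithLp.toLp 2 (u + v • φ)) : ℝ) * Complex.I) *
          Complex.exp (v * p.2 * Complex.I) := by
    intro p
    rw [← Complex.exp_add, EuclideanSpace.inner_eq_star_dotProduct]
    congr 1
    simp only [star_trivial, add_dotProduct, smul_dotProduct, smul_eq_mul]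
    push_cast
    ring
  simp_rw [hsplit]
  rw [integral_prod_mul (fun x : EuclideanSpace ℝ (Fin d) =>
      Complex.exp ((inner ℝ x (WithLp.toLp 2 (u + v • φ)) : ℝ) * Complex.I))
    (fun y : ℝ => Complex.exp (v * y * Complex.I)), ← charFun_apply, ← charFun_apply_real,
    charFun_gaussianKernel hb, charFun_gaussianReal_zero, ← Complex.exp_add]
  congr 1
  simp only [mulVec_add, mulVec_smul, add_dotProduct, smul_dotProduct, dotProduct_add,
    dotProduct_smul, smul_eq_mul, hsymm]
  push_cast
  ring

theorem quadForm_kalmanStep_cov (σ : ℝ) {b : Belief d} (hb : b.cov.PosDef) (φ u : Fin d → ℝ)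
    (y : ℝ) : u ⬝ᵥ (kalmanStep σ b φ y).cov *ᵥ u =
      u ⬝ᵥ b.cov *ᵥ u - (φ ⬝ᵥ b.cov *ᵥ φ + σ ^ 2)⁻¹ * (u ⬝ᵥ b.cov *ᵥ φ) ^ 2 := by
  have hsymm : φ ⬝ᵥ b.cov *ᵥ u = u ⬝ᵥ b.cov *ᵥ φ := by
    rw [dotProduct_mulVec, ← mulVec_transpose, dotProduct_comm]
    congr 2
    exact (conjTranspose_eq_transpose_of_trivial b.cov).symm.trans hb.isHermitian
  simp only [kalmanStep, sub_mulVec, smul_mulVec, dotProduct_sub, dotProduct_smul, smul_eq_mul]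
  rw [← mulVec_mulVec, ← mulVec_mulVec, vecMulVec_mulVec, op_smul_eq_smul, mulVec_smul,
    dotProduct_smul, hsymm, smul_eq_mul]
  ring

/-- Innovation form: the new mean is affine in `y`. As the new covariance does not involve `y`,
redrawing `θ` amounts to adding to this mean a centred Gaussian independent of `y`. -/
theorem kalmanStep_mean (σ : ℝ) (b : Belief d) (φ : Fin d → ℝ) (y : ℝ) :
    (kalmanStep σ b φ y).mean =
      b.mean + ((y - φ ⬝ᵥ b.mean) * (φ ⬝ᵥ b.cov *ᵥ φ + σ ^ 2)⁻¹) • (b.cov *ᵥ φ) := by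
  simp only [kalmanStep, sub_mulVec, smul_mulVec, one_mulVec]
  rw [← mulVec_mulVec, vecMulVec_mulVec, op_smul_eq_smul, mulVec_smul]
  module

/-- A Gaussian belief centred at the origin. -/
def Belief.centered (b : Belief d) : Belief d := ⟨0, b.cov⟩

theorem gaussianKernel_eq_map_centered (b : Belief d) :
    gaussianKernel d b =
      (gaussianKernel d b.centered).map fun ζ => WithLp.toLp 2 b.mean + ζ := by
  rw [gaussianKernel_apply, gaussianKernel_apply, multivariateGaussian, multivariateGaussian,
    Measure.map_map (by fun_prop) (by fun_prop)]
  congr 1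
  ext1 z
  simp [Belief.centered]

/-- Bayes' rule for one linear observation `y = ⟨φ, θ⟩ + ε`: the joint law of `(θ, y)` is unchanged
when `θ` is redrawn from the belief returned by the Kalman step. -/
theorem map_observe_eq_map_redraw {b : Belief d} (hb : b.cov.PosDef) {σ : ℝ} (hσ : 0 < σ)
    (φ : Fin d → ℝ) :
    ((gaussianKernel d b).prod (gaussianReal 0 (σ ^ 2).toNNReal)).map
      (fun p => (p.1, φ ⬝ᵥ p.1.ofLp + p.2)) =
    (((gaussianKernel d b).prod (gaussianReal 0 (σ ^ 2).toNNReal)).prod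
      (gaussianKernel d (kalmanStep σ b φ 0).centered)).map
      (fun q => (WithLp.toLp 2 (kalmanStep σ b φ (φ ⬝ᵥ q.1.1.ofLp + q.1.2)).mean + q.2,
        φ ⬝ᵥ q.1.1.ofLp + q.1.2)) := by
  have hq := quadForm_nonneg hb φ
  have hD : φ ⬝ᵥ b.cov *ᵥ φ + σ ^ 2 ≠ 0 := by positivity
  have hm1 : Measurable fun p : EuclideanSpace ℝ (Fin d) × ℝ => (p.1, φ ⬝ᵥ p.1.ofLp + p.2) := by
    fun_prop
  have hm2 : Measurable fun q : (EuclideanSpace ℝ (Fin d) × ℝ) × EuclideanSpace ℝ (Fin d) =>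
      (WithLp.toLp 2 (kalmanStep σ b φ (φ ⬝ᵥ q.1.1.ofLp + q.1.2)).mean + q.2,
        φ ⬝ᵥ q.1.1.ofLp + q.1.2) := by
    simp only [kalmanStep_mean]
    fun_prop
  have := Measure.isProbabilityMeasure_map
    (μ := (gaussianKernel d b).prod (gaussianReal 0 (σ ^ 2).toNNReal)) hm1.aemeasurable
  have := Measure.isProbabilityMeasure_map
    (μ := ((gaussianKernel d b).prod (gaussianReal 0 (σ ^ 2).toNNReal)).prod
      (gaussianKernel d (kalmanStep σ b φ 0).centered)) hm2.aemeasurable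
  refine Measure.ext_of_charFunDual (funext fun Λ => ?_)
  obtain ⟨u, v, hΛ⟩ := exists_dual_prod Λ
  rw [charFunDual_apply, charFunDual_apply, integral_map hm1.aemeasurable (by fun_prop),
    integral_map hm2.aemeasurable (by fun_prop)]
  simp only [hΛ]
  rw [charFunDual_map_observe hb φ σ u v]
  set D := φ ⬝ᵥ b.cov *ᵥ φ + σ ^ 2 with hDdef
  set p := u ⬝ᵥ b.cov *ᵥ φ with hp
  -- The exponent separates into a constant, a multiple of `y` with coefficient `v + D⁻¹ p`, and the
  -- independent part `⟨u, ζ⟩`.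
  have hsplit : ∀ q : (EuclideanSpace ℝ (Fin d) × ℝ) × EuclideanSpace ℝ (Fin d),
      Complex.exp (((u ⬝ᵥ (WithLp.toLp 2 (kalmanStep σ b φ (φ ⬝ᵥ q.1.1.ofLp + q.1.2)).mean +
        q.2).ofLp + v * (φ ⬝ᵥ q.1.1.ofLp + q.1.2) : ℝ) : ℂ) * Complex.I) =
      (Complex.exp ((u ⬝ᵥ b.mean - (φ ⬝ᵥ b.mean) * D⁻¹ * p : ℝ) * Complex.I) *
        Complex.exp ((((0 : Fin d → ℝ) ⬝ᵥ q.1.1.ofLp +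
          (v + D⁻¹ * p) * (φ ⬝ᵥ q.1.1.ofLp + q.1.2) : ℝ) : ℂ) * Complex.I)) *
        Complex.exp ((inner ℝ q.2 (WithLp.toLp 2 u) : ℝ) * Complex.I) := by
    intro q
    rw [← Complex.exp_add, ← Complex.exp_add, EuclideanSpace.inner_eq_star_dotProduct,
      kalmanStep_mean, ← hDdef]
    congr 1
    simp only [star_trivial, WithLp.ofLp_add, dotProduct_add, dotProduct_smul, smul_eq_mul,
      zero_dotProduct, ← hp]
    push_cast
    ring
  simp_rw [hsplit]
  rw [integral_prod_mul (fun x : EuclideanSpace ℝ (Fin d) × ℝ =>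
      Complex.exp ((u ⬝ᵥ b.mean - (φ ⬝ᵥ b.mean) * D⁻¹ * p : ℝ) * Complex.I) *
        Complex.exp ((((0 : Fin d → ℝ) ⬝ᵥ x.1.ofLp +
          (v + D⁻¹ * p) * (φ ⬝ᵥ x.1.ofLp + x.2) : ℝ) : ℂ) * Complex.I))
    (fun ζ : EuclideanSpace ℝ (Fin d) =>
      Complex.exp ((inner ℝ ζ (WithLp.toLp 2 u) : ℝ) * Complex.I)), integral_const_mul,
    charFunDual_map_observe hb φ σ 0, ← charFun_apply,
    charFun_gaussianKernel (b := (kalmanStep σ b φ 0).centered) (posDef_kalmanStep_cov hσ hb φ 0),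
    ← Complex.exp_add, ← Complex.exp_add]
  -- The quadratic parts agree: `(v + p / D)² D + (uᵀ Σ u - p² / D) = uᵀ Σ u + 2 v p + v² D`.
  congr 1
  simp only [Belief.centered, quadForm_kalmanStep_cov σ hb, ← hDdef, ← hp, zero_dotProduct,
    dotProduct_zero]
  have hDc : (D : ℂ) ≠ 0 := by exact_mod_cast hD
  push_cast
  field_simp
  ring

theorem lintegral_observe_eq_redraw {b : Belief d} (hb : b.cov.PosDef) {σ : ℝ} (hσ : 0 < σ)
    (φ : Fin d → ℝ) {G : EuclideanSpace ℝ (Fin d) × Belief d → ENNReal} (hG : Measurable G) :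
    ∫⁻ θ, ∫⁻ ε, G (θ, kalmanStep σ b φ (φ ⬝ᵥ θ.ofLp + ε))
        ∂gaussianReal 0 (σ ^ 2).toNNReal ∂gaussianKernel d b =
      ∫⁻ θ, ∫⁻ ε, (∫⁻ θ', G (θ', kalmanStep σ b φ (φ ⬝ᵥ θ.ofLp + ε))
        ∂gaussianKernel d (kalmanStep σ b φ (φ ⬝ᵥ θ.ofLp + ε)))
        ∂gaussianReal 0 (σ ^ 2).toNNReal ∂gaussianKernel d b := by
  have hk : Measurable fun x : EuclideanSpace ℝ (Fin d) × ℝ => G (x.1, kalmanStep σ b φ x.2) :=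
    hG.comp (measurable_fst.prodMk (measurable_kalmanStep σ φ measurable_const measurable_snd))
  have hmap := congrArg (fun μ => ∫⁻ x, G (x.1, kalmanStep σ b φ x.2) ∂μ)
    (map_observe_eq_map_redraw hb hσ φ)
  have hm2 : Measurable fun q : (EuclideanSpace ℝ (Fin d) × ℝ) × EuclideanSpace ℝ (Fin d) =>
      (WithLp.toLp 2 (kalmanStep σ b φ (φ ⬝ᵥ q.1.1.ofLp + q.1.2)).mean + q.2,
        φ ⬝ᵥ q.1.1.ofLp + q.1.2) := by
    simp only [kalmanStep_mean]
    fun_prop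
  simp only at hmap
  rw [lintegral_map hk (by fun_prop), lintegral_map hk hm2] at hmap
  have h1 := lintegral_prod (μ := gaussianKernel d b) (ν := gaussianReal 0 (σ ^ 2).toNNReal)
    (fun p : EuclideanSpace ℝ (Fin d) × ℝ => G (p.1, kalmanStep σ b φ (φ ⬝ᵥ p.1.ofLp + p.2)))
    (hk.comp (by fun_prop : Measurable fun p : EuclideanSpace ℝ (Fin d) × ℝ =>
      (p.1, φ ⬝ᵥ p.1.ofLp + p.2))).aemeasurable
  refine h1.symm.trans (hmap.trans ?_)
  refine (lintegral_prod _ (hk.comp hm2).aemeasurable).trans ?_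
  refine (lintegral_prod _ (hk.comp hm2).lintegral_prod_right'.aemeasurable).trans ?_
  refine lintegral_congr fun θ => lintegral_congr fun ε => ?_
  set y := φ ⬝ᵥ θ.ofLp + ε
  rw [gaussianKernel_eq_map_centered (kalmanStep σ b φ y)]
  exact (lintegral_map (f := fun θ' => G (θ', kalmanStep σ b φ y))
    (hG.comp (measurable_id.prodMk measurable_const)) (by fun_prop)).symm

end KalmanStep

/-! ### Bayes' rule for one episode, item by item. -/

section KalmanUpdate

variable {L d : ℕ}

/-- The law of the noise vector of one episode. -/
noncomputable def noiseLaw (L : ℕ) (σ : ℝ) : Measure (Fin L → ℝ) :=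
  Measure.pi fun _ : Fin L => gaussianReal 0 (σ ^ 2).toNNReal

instance isProbabilityMeasure_noiseLaw (σ : ℝ) : IsProbabilityMeasure (noiseLaw L σ) := by
  unfold noiseLaw; infer_instance

/-- The expectation of `G` after observing the items of a list one at a time, each with a fresh
noise, when the coefficient vector is the first component. -/
noncomputable def observeList (Φ : Matrix (Fin L) (Fin d) ℝ) (σ : ℝ)
    (G : EuclideanSpace ℝ (Fin d) × Belief d → ENNReal) :
    List (Fin L) → EuclideanSpace ℝ (Fin d) × Belief d → ENNReal
  | [], p => G p
  | e :: l, p => ∫⁻ ε, observeList Φ σ G l (p.1, kalmanStep σ p.2 (Φ e) (Φ e ⬝ᵥ p.1.ofLp + ε))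
      ∂gaussianReal 0 (σ ^ 2).toNNReal

theorem measurable_observeList (Φ : Matrix (Fin L) (Fin d) ℝ) (σ : ℝ)
    {G : EuclideanSpace ℝ (Fin d) × Belief d → ENNReal} (hG : Measurable G) (l : List (Fin L)) :
    Measurable (observeList Φ σ G l) := by
  induction l with
  | nil => exact hG
  | cons e l ih =>
    refine Measurable.lintegral_prod_right' (f := fun q : (EuclideanSpace ℝ (Fin d) × Belief d) × ℝ
      => observeList Φ σ G l (q.1.1, kalmanStep σ q.1.2 (Φ e) (Φ e ⬝ᵥ q.1.1.ofLp + q.2))) ?_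
    refine ih.comp ((measurable_fst.comp measurable_fst).prodMk ?_)
    exact measurable_kalmanStep σ _ (measurable_snd.comp measurable_fst) (by fun_prop)

theorem measurable_lintegral_gaussianKernel
    {G : EuclideanSpace ℝ (Fin d) × Belief d → ENNReal} (hG : Measurable G) :
    Measurable fun b : Belief d => ∫⁻ θ, G (θ, b) ∂gaussianKernel d b :=
  Measurable.lintegral_kernel_prod_right (κ := gaussianKernel d) (f := fun b θ => G (θ, b))
    (hG.comp measurable_swap)

/-- After the first observation `θ` may be redrawn from the updated belief on both sides; inside,
the remaining list then starts from a matching pair of coefficients and belief, so the induction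
closes. -/
theorem lintegral_observeList_eq_redraw (Φ : Matrix (Fin L) (Fin d) ℝ) {σ : ℝ} (hσ : 0 < σ)
    {G : EuclideanSpace ℝ (Fin d) × Belief d → ENNReal} (hG : Measurable G) (l : List (Fin L))
    {b : Belief d} (hb : b.cov.PosDef) :
    ∫⁻ θ, observeList Φ σ G l (θ, b) ∂gaussianKernel d b =
      ∫⁻ θ, observeList Φ σ (fun p => ∫⁻ θ', G (θ', p.2) ∂gaussianKernel d p.2) l (θ, b)
        ∂gaussianKernel d b := by
  have hH : Measurable fun p : EuclideanSpace ℝ (Fin d) × Belief d =>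
      ∫⁻ θ', G (θ', p.2) ∂gaussianKernel d p.2 :=
    (measurable_lintegral_gaussianKernel hG).comp measurable_snd
  induction l generalizing b with
  | nil => simp [observeList]
  | cons e l ih =>
    simp only [observeList]
    rw [lintegral_observe_eq_redraw hb hσ (Φ e) (measurable_observeList Φ σ hG l),
      lintegral_observe_eq_redraw hb hσ (Φ e) (measurable_observeList Φ σ hH l)]
    exact lintegral_congr fun θ => lintegral_congr fun ε =>
      ih (posDef_kalmanStep_cov hσ hb _ _)

/-- Without repetitions each coordinate of the noise vector is used once, so integrating out the
coordinates of the list is the same as drawing fresh noises in turn. -/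
theorem lmarginal_foldl_kalmanStep (Φ : Matrix (Fin L) (Fin d) ℝ) (σ : ℝ)
    {G : EuclideanSpace ℝ (Fin d) × Belief d → ENNReal} (hG : Measurable G)
    (θ : EuclideanSpace ℝ (Fin d)) (l : List (Fin L)) (hl : l.Nodup) (b : Belief d)
    (x : Fin L → ℝ) :
    lmarginal (fun _ : Fin L => gaussianReal 0 (σ ^ 2).toNNReal) l.toFinset
      (fun η => G (θ, l.foldl (fun b e => kalmanStep σ b (Φ e) (linWeight Φ θ e + η e)) b)) x =
      observeList Φ σ G l (θ, b) := by
  induction l generalizing b x with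
  | nil => simp [observeList]
  | cons e l ih =>
    obtain ⟨he, hl'⟩ := List.nodup_cons.1 hl
    have hmeas : Measurable fun η : Fin L → ℝ => G (θ, (e :: l).foldl
        (fun b e => kalmanStep σ b (Φ e) (linWeight Φ θ e + η e)) b) := by
      refine hG.comp (measurable_const.prodMk ?_)
      exact measurable_foldl_kalmanStep (w := fun (η : Fin L → ℝ) e => linWeight Φ θ e + η e)
          Φ σ (e :: l)
        measurable_const (by fun_prop)
    rw [List.toFinset_cons, lmarginal_insert _ hmeas (by simpa using he), observeList]
    refine lintegral_congr fun ε => ?_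
    rw [← ih hl' (kalmanStep σ b (Φ e) (Φ e ⬝ᵥ θ.ofLp + ε)) (Function.update x e ε)]
    refine lintegral_congr fun y => ?_
    have hy : Function.updateFinset (Function.update x e ε) l.toFinset y e = ε := by
      rw [Function.updateFinset, dif_neg (by simpa using he), Function.update_self]
    simp only [List.foldl_cons, hy]
    rfl

theorem lintegral_kalmanUpdate_eq_observeList (Φ : Matrix (Fin L) (Fin d) ℝ) (σ : ℝ)
    {G : EuclideanSpace ℝ (Fin d) × Belief d → ENNReal} (hG : Measurable G)
    (θ : EuclideanSpace ℝ (Fin d)) (A : Finset (Fin L)) (b : Belief d) :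
    ∫⁻ η, G (θ, kalmanUpdate Φ σ b A (linWeight Φ θ + η)) ∂noiseLaw L σ =
      observeList Φ σ G (A.sort (· ≤ ·)) (θ, b) := by
  set f : (Fin L → ℝ) → ENNReal := fun η => G (θ, (A.sort (· ≤ ·)).foldl
    (fun b e => kalmanStep σ b (Φ e) (linWeight Φ θ e + η e)) b) with hf
  have hmeas : Measurable f :=
    hG.comp (measurable_const.prodMk (measurable_foldl_kalmanStep
      (w := fun (η : Fin L → ℝ) e => linWeight Φ θ e + η e) Φ σ _ measurable_const (by fun_prop)))
  have hconst : lmarginal (fun _ : Fin L => gaussianReal 0 (σ ^ 2).toNNReal) A f =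
      fun _ => observeList Φ σ G (A.sort (· ≤ ·)) (θ, b) := by
    funext x
    have := lmarginal_foldl_kalmanStep Φ σ hG θ _ (Finset.sort_nodup A (· ≤ ·)) b x
    rwa [Finset.sort_toFinset] at this
  have h := lintegral_eq_lmarginal_univ (μ := fun _ : Fin L => gaussianReal 0 (σ ^ 2).toNNReal)
    (f := f) 0
  -- Once the coordinates in `A` are integrated out the integrand is constant, so the others
  -- contribute only total mass 1.
  rw [← Finset.sdiff_union_of_subset (Finset.subset_univ A),
    lmarginal_union _ f hmeas Finset.sdiff_disjoint, hconst] at h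
  refine Eq.trans ?_ (h.trans ?_)
  · rfl
  · simp [lmarginal]

/-- Bayes' rule for one episode: the joint law of the coefficients and the updated belief is
unchanged when the coefficients are redrawn from the updated belief. -/
theorem lintegral_kalmanUpdate_eq_redraw (Φ : Matrix (Fin L) (Fin d) ℝ) {σ : ℝ} (hσ : 0 < σ)
    {G : EuclideanSpace ℝ (Fin d) × Belief d → ENNReal} (hG : Measurable G)
    (A : Finset (Fin L)) {b : Belief d} (hb : b.cov.PosDef) :
    ∫⁻ θ, ∫⁻ η, G (θ, kalmanUpdate Φ σ b A (linWeight Φ θ + η)) ∂noiseLaw L σ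
        ∂gaussianKernel d b =
      ∫⁻ θ, ∫⁻ η, (∫⁻ θ', G (θ', kalmanUpdate Φ σ b A (linWeight Φ θ + η))
        ∂gaussianKernel d (kalmanUpdate Φ σ b A (linWeight Φ θ + η))) ∂noiseLaw L σ
        ∂gaussianKernel d b := by
  have hH : Measurable fun p : EuclideanSpace ℝ (Fin d) × Belief d =>
      ∫⁻ θ', G (θ', p.2) ∂gaussianKernel d p.2 :=
    (measurable_lintegral_gaussianKernel hG).comp measurable_snd
  have h2 := fun θ => lintegral_kalmanUpdate_eq_observeList Φ σ hH θ A b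
  simp only at h2
  simp_rw [lintegral_kalmanUpdate_eq_observeList Φ σ hG, h2]
  exact lintegral_observeList_eq_redraw Φ hσ hG _ hb

end KalmanUpdate

/-! ### From conditional laws to iterated integrals. -/

section CondLaw

variable {Ω α β γ : Type*} {𝓖 : MeasurableSpace Ω} [mΩ : MeasurableSpace Ω]
  [MeasurableSpace α] [MeasurableSpace β] [MeasurableSpace γ] {P : Measure Ω}
  [IsProbabilityMeasure P]

theorem HasCondLaw.measure_inter (h𝓖 : 𝓖 ≤ mΩ) {X : Ω → α}
    (hX : Measurable X) {k : Kernel Ω α} [IsMarkovKernel k]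
    (h : HasCondLaw P 𝓖 X fun ω => k ω) {s : Set Ω} (hs : MeasurableSet[𝓖] s)
    {B : Set α} (hB : MeasurableSet B) :
    P (s ∩ X ⁻¹' B) = ∫⁻ ω in s, k ω B ∂P := by
  have h1 : ∫ ω in s, (P⟦X ⁻¹' B | 𝓖⟧) ω ∂P = P.real (s ∩ X ⁻¹' B) := by
    rw [setIntegral_condExp h𝓖 ((integrable_const _).indicator (hX hB)) hs,
      setIntegral_indicator (hX hB), setIntegral_const, smul_eq_mul, mul_one]
  have h2 : ∫ ω in s, (P⟦X ⁻¹' B | 𝓖⟧) ω ∂P = ∫ ω in s, (k ω B).toReal ∂P :=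
    integral_congr_ae (ae_restrict_of_ae (h B hB))
  rw [integral_toReal (k.measurable_coe hB).aemeasurable
    (Filter.Eventually.of_forall fun ω => measure_lt_top _ _), h1, measureReal_def] at h2
  refine (ENNReal.toReal_eq_toReal_iff' (measure_ne_top _ _) ?_).1 h2
  refine ((lintegral_mono fun ω => prob_le_one).trans_lt ?_).ne
  simp

/-- Integrating a function of the past and of one fresh draw. -/
theorem HasCondLaw.lintegral_eq (h𝓖 : 𝓖 ≤ mΩ) {X : Ω → α}
    (hX : Measurable X) {Z : Ω → γ} (hZ : Measurable[𝓖] Z) {k : Kernel γ α} [IsMarkovKernel k]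
    (h : HasCondLaw P 𝓖 X fun ω => k (Z ω)) {Y : Ω → β} (hY : Measurable[𝓖] Y)
    {G : β × α → ENNReal} (hG : Measurable G) :
    ∫⁻ ω, G (Y ω, X ω) ∂P = ∫⁻ ω, ∫⁻ x, G (Y ω, x) ∂k (Z ω) ∂P := by
  have hY' : Measurable Y := hY.mono h𝓖 le_rfl
  have hmap : Measurable (Prod.map Y (id : α → α)) := hY'.prodMap measurable_id
  set k' : Kernel Ω α := k.comap Z (hZ.mono h𝓖 le_rfl) with hk'
  have hμ : P.map (fun ω => (Y ω, X ω)) = (P ⊗ₘ k').map (Prod.map Y id) := by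
    have := Measure.isProbabilityMeasure_map (μ := P) (hY'.prodMk hX).aemeasurable
    -- Rectangles determine the joint law, and on them the claim is the defining property of
    -- conditional expectation.
    refine Measure.ext_prod fun {s B} hs hB => ?_
    rw [Measure.map_apply (hY'.prodMk hX) (hs.prod hB), Measure.map_apply hmap (hs.prod hB),
      show Prod.map Y (id : α → α) ⁻¹' (s ×ˢ B) = (Y ⁻¹' s) ×ˢ B by ext; simp,
      Measure.compProd_apply_prod (hY' hs) hB,
      ← HasCondLaw.measure_inter (k := k') h𝓖 hX h (hY hs) hB]
    rfl
  rw [← lintegral_map hG (hY'.prodMk hX), hμ, lintegral_map hG hmap]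
  exact Measure.lintegral_compProd (hG.comp hmap)

end CondLaw

/-! ### Belief draw followed by an oracle call, as one kernel. -/

section Oracle

variable {L d : ℕ} {𝒜 : Finset (Finset (Fin L))}

theorem measurable_linWeight (Φ : Matrix (Fin L) (Fin d) ℝ) : Measurable (linWeight Φ) := by
  refine measurable_pi_lambda _ fun e => ?_
  simp only [linWeight, mulVec]
  fun_prop

theorem linWeight_apply (Φ : Matrix (Fin L) (Fin d) ℝ) (θ : EuclideanSpace ℝ (Fin d))
    (e : Fin L) : linWeight Φ θ e = Φ e ⬝ᵥ θ.ofLp := rfl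

/-- The oracle's answer to the weights `Φ θ`, as a kernel in `θ`. -/
noncomputable def Oracle.linKernel (oracle : Oracle L 𝒜) (Φ : Matrix (Fin L) (Fin d) ℝ) :
    Kernel (EuclideanSpace ℝ (Fin d)) (Finset (Fin L)) :=
  oracle.law.comap (linWeight Φ) (measurable_linWeight Φ)

instance isMarkovKernel_linKernel (oracle : Oracle L 𝒜) (Φ : Matrix (Fin L) (Fin d) ℝ) :
    IsMarkovKernel (oracle.linKernel Φ) := by
  have := oracle.isMarkov
  unfold Oracle.linKernel
  infer_instance

/-- Draw coefficients from a belief, and ask the oracle for a set. -/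
noncomputable def Oracle.playKernel (oracle : Oracle L 𝒜) (Φ : Matrix (Fin L) (Fin d) ℝ) :
    Kernel (Belief d) (EuclideanSpace ℝ (Fin d) × Finset (Fin L)) :=
  gaussianKernel d ⊗ₖ Kernel.prodMkLeft (Belief d) (oracle.linKernel Φ)

instance isMarkovKernel_playKernel (oracle : Oracle L 𝒜) (Φ : Matrix (Fin L) (Fin d) ℝ) :
    IsMarkovKernel (oracle.playKernel Φ) := by
  unfold Oracle.playKernel
  infer_instance

theorem lintegral_playKernel (oracle : Oracle L 𝒜) (Φ : Matrix (Fin L) (Fin d) ℝ) (b : Belief d)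
    {g : EuclideanSpace ℝ (Fin d) × Finset (Fin L) → ENNReal} (hg : Measurable g) :
    ∫⁻ x, g x ∂oracle.playKernel Φ b =
      ∫⁻ θ, ∫⁻ A, g (θ, A) ∂oracle.linKernel Φ θ ∂gaussianKernel d b := by
  rw [Oracle.playKernel, Kernel.lintegral_compProd _ _ _ hg]
  rfl

/-- One episode of Bayesian updating leaves the coefficients and the benchmark set distributed as
a fresh draw from the current belief. -/
theorem lintegral_playKernel_kalmanUpdate (oracle : Oracle L 𝒜) (Φ : Matrix (Fin L) (Fin d) ℝ)
    {σ : ℝ} (hσ : 0 < σ) {b : Belief d} (hb : b.cov.PosDef) (A : Finset (Fin L))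
    {G : (EuclideanSpace ℝ (Fin d) × Finset (Fin L)) × Belief d → ENNReal} (hG : Measurable G) :
    ∫⁻ x, ∫⁻ η, G (x, kalmanUpdate Φ σ b A (linWeight Φ x.1 + η)) ∂noiseLaw L σ
        ∂oracle.playKernel Φ b =
      ∫⁻ x, ∫⁻ η, (∫⁻ x', G (x', kalmanUpdate Φ σ b A (linWeight Φ x.1 + η))
        ∂oracle.playKernel Φ (kalmanUpdate Φ σ b A (linWeight Φ x.1 + η))) ∂noiseLaw L σ
        ∂oracle.playKernel Φ b := by
  have hU : Measurable fun q : (EuclideanSpace ℝ (Fin d) × Finset (Fin L)) × (Fin L → ℝ) =>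
      kalmanUpdate Φ σ b A (linWeight Φ q.1.1 + q.2) :=
    measurable_kalmanUpdate Φ σ measurable_const measurable_const
      (((measurable_linWeight Φ).comp (measurable_fst.comp measurable_fst)).add measurable_snd)
  have hV : Measurable fun q : EuclideanSpace ℝ (Fin d) × (Fin L → ℝ) =>
      kalmanUpdate Φ σ b A (linWeight Φ q.1 + q.2) :=
    measurable_kalmanUpdate Φ σ measurable_const measurable_const
      (((measurable_linWeight Φ).comp measurable_fst).add measurable_snd)
  have hGt : Measurable fun p : EuclideanSpace ℝ (Fin d) × Belief d =>
      ∫⁻ B, G ((p.1, B), p.2) ∂oracle.linKernel Φ p.1 :=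
    Measurable.lintegral_kernel_prod_right'
      (κ := (oracle.linKernel Φ).comap (Prod.fst : EuclideanSpace ℝ (Fin d) × Belief d → _)
        measurable_fst)
      (f := fun q : (EuclideanSpace ℝ (Fin d) × Belief d) × Finset (Fin L) =>
        G ((q.1.1, q.2), q.1.2)) (hG.comp (by fun_prop))
  have hH : Measurable fun b' : Belief d => ∫⁻ x', G (x', b') ∂oracle.playKernel Φ b' :=
    Measurable.lintegral_kernel_prod_right (κ := oracle.playKernel Φ) (f := fun b' x => G (x, b'))
      (hG.comp measurable_swap)
  have hL : Measurable fun x : EuclideanSpace ℝ (Fin d) × Finset (Fin L) =>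
      ∫⁻ η, G (x, kalmanUpdate Φ σ b A (linWeight Φ x.1 + η)) ∂noiseLaw L σ :=
    Measurable.lintegral_prod_right' (f := fun q : (EuclideanSpace ℝ (Fin d) × Finset (Fin L)) ×
      (Fin L → ℝ) => G (q.1, kalmanUpdate Φ σ b A (linWeight Φ q.1.1 + q.2)))
      (hG.comp (measurable_fst.prodMk hU))
  have hR : Measurable fun x : EuclideanSpace ℝ (Fin d) × Finset (Fin L) =>
      ∫⁻ η, (∫⁻ x', G (x', kalmanUpdate Φ σ b A (linWeight Φ x.1 + η))
        ∂oracle.playKernel Φ (kalmanUpdate Φ σ b A (linWeight Φ x.1 + η))) ∂noiseLaw L σ :=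
    Measurable.lintegral_prod_right' (f := fun q : (EuclideanSpace ℝ (Fin d) × Finset (Fin L)) ×
      (Fin L → ℝ) => ∫⁻ x', G (x', kalmanUpdate Φ σ b A (linWeight Φ q.1.1 + q.2))
        ∂oracle.playKernel Φ (kalmanUpdate Φ σ b A (linWeight Φ q.1.1 + q.2)))
      (hH.comp hU)
  rw [lintegral_playKernel oracle Φ b hL, lintegral_playKernel oracle Φ b hR]
  -- Given `θ`, the benchmark set and the noise are independent and the update ignores the set.
  -- Integrating the set out first leaves a function of coefficients and belief, to which Bayes'
  -- rule applies.
  have hswap : ∀ θ, ∫⁻ B, ∫⁻ η, G ((θ, B), kalmanUpdate Φ σ b A (linWeight Φ θ + η))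
      ∂noiseLaw L σ ∂oracle.linKernel Φ θ = ∫⁻ η, ∫⁻ B, G ((θ, B), kalmanUpdate Φ σ b A
        (linWeight Φ θ + η)) ∂oracle.linKernel Φ θ ∂noiseLaw L σ := fun θ =>
    lintegral_lintegral_swap (hG.comp ((measurable_const.prodMk measurable_fst).prodMk
      (hV.comp (measurable_const.prodMk measurable_snd)))).aemeasurable
  simp only [hswap, lintegral_const, measure_univ, mul_one]
  rw [lintegral_kalmanUpdate_eq_redraw Φ hσ hGt A hb]
  refine lintegral_congr fun θ => lintegral_congr fun η => ?_
  exact (lintegral_playKernel oracle Φ _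
    (g := fun x => G (x, kalmanUpdate Φ σ b A (linWeight Φ θ + η)))
    (hG.comp (measurable_id.prodMk measurable_const))).symm

end Oracle

/-! ### The history of a run and the posterior law of `(θ*, A*)`. -/

namespace Run

section Past

variable {Ω : Type*} {L d : ℕ} (X : Run Ω L d)

theorem past_mono {s t : ℕ} (h : s ≤ t) : X.past s ≤ X.past t :=
  sup_le le_sup_left (le_sup_of_le_right (iSup_le fun i : Fin s =>
    le_iSup (fun r : Fin t => MeasurableSpace.comap (X.theta r) inferInstance ⊔
      MeasurableSpace.comap (X.chosen r) inferInstance ⊔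
      MeasurableSpace.comap (X.weight r) inferInstance) ⟨i, i.2.trans_le h⟩))

theorem measurable_thetaStar_past (t : ℕ) : Measurable[X.past t] X.thetaStar :=
  (comap_measurable _).mono (le_sup_left.trans le_sup_left) le_rfl

theorem measurable_optSet_past (t : ℕ) : Measurable[X.past t] X.optSet :=
  (comap_measurable _).mono (le_sup_right.trans le_sup_left) le_rfl

theorem comap_le_past_succ (t : ℕ) :
    MeasurableSpace.comap (X.theta t) inferInstance ⊔
      MeasurableSpace.comap (X.chosen t) inferInstance ⊔
      MeasurableSpace.comap (X.weight t) inferInstance ≤ X.past (t + 1) :=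
  le_sup_of_le_right (le_iSup (fun r : Fin (t + 1) =>
    MeasurableSpace.comap (X.theta r) inferInstance ⊔
      MeasurableSpace.comap (X.chosen r) inferInstance ⊔
      MeasurableSpace.comap (X.weight r) inferInstance) (Fin.last t))

theorem measurable_chosen_past_succ (t : ℕ) : Measurable[X.past (t + 1)] (X.chosen t) :=
  (comap_measurable _).mono ((le_sup_right.trans le_sup_left).trans (X.comap_le_past_succ t)) le_rfl

theorem measurable_weight_past_succ (t : ℕ) : Measurable[X.past (t + 1)] (X.weight t) :=
  (comap_measurable _).mono (le_sup_right.trans (X.comap_le_past_succ t)) le_rfl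

theorem measurable_beliefAt_past (Φ : Matrix (Fin L) (Fin d) ℝ) (lam σ : ℝ) (t : ℕ) :
    Measurable[X.past t] (X.beliefAt Φ lam σ t) := by
  induction t with
  | zero => exact measurable_const
  | succ t ih =>
    let _ : MeasurableSpace Ω := X.past (t + 1)
    exact measurable_kalmanUpdate Φ σ (ih.mono (X.past_mono (Nat.le_succ t)) le_rfl)
      (X.measurable_chosen_past_succ t) (X.measurable_weight_past_succ t)

theorem posDef_beliefAt_cov (Φ : Matrix (Fin L) (Fin d) ℝ) {lam σ : ℝ} (hlam : 0 < lam)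
    (hσ : 0 < σ) (t : ℕ) (ω : Ω) : (X.beliefAt Φ lam σ t ω).cov.PosDef :=
  posDef_belief_cov Φ _ hlam hσ _ t

end Past

namespace IsCombLinTS

variable {Ω : Type*} [mΩ : MeasurableSpace Ω] {L d : ℕ} {P : Measure Ω}
  {Φ : Matrix (Fin L) (Fin d) ℝ} {lam σ : ℝ} {𝒜 : Finset (Finset (Fin L))} {oracle : Oracle L 𝒜}
  {n : ℕ} {X : Run Ω L d}

theorem past_le (hX : X.IsCombLinTS P Φ lam σ oracle n) {t : ℕ} (ht : t ≤ n) : X.past t ≤ mΩ :=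
  sup_le (sup_le hX.measurable_thetaStar.comap_le hX.measurable_optSet.comap_le)
    (iSup_le fun s => sup_le (sup_le (hX.measurable_theta s (s.2.trans_le ht)).comap_le
      (hX.measurable_chosen s (s.2.trans_le ht)).comap_le)
      (hX.measurable_weight s (s.2.trans_le ht)).comap_le)

theorem measurable_beliefAt (hX : X.IsCombLinTS P Φ lam σ oracle n) {t : ℕ} (ht : t ≤ n) :
    Measurable (X.beliefAt Φ lam σ t) :=
  (X.measurable_beliefAt_past Φ lam σ t).mono (hX.past_le ht) le_rfl

theorem measurable_noise (hX : X.IsCombLinTS P Φ lam σ oracle n) {t : ℕ} (ht : t < n) :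
    Measurable (X.noise Φ t) :=
  (hX.measurable_weight t ht).sub ((measurable_linWeight Φ).comp hX.measurable_thetaStar)

variable [IsProbabilityMeasure P] {β : Type*} [MeasurableSpace β]

/-- Given the past, `(θ_t, A^t)` is a draw of coefficients and set from the current belief. -/
theorem lintegral_play (hX : X.IsCombLinTS P Φ lam σ oracle n) {t : ℕ} (ht : t < n) {Y : Ω → β}
    (hY : Measurable[X.past t] Y)
    {G : β × EuclideanSpace ℝ (Fin d) × Finset (Fin L) → ENNReal} (hG : Measurable G) :
    ∫⁻ ω, G (Y ω, X.theta t ω, X.chosen t ω) ∂P =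
      ∫⁻ ω, ∫⁻ x, G (Y ω, x) ∂oracle.playKernel Φ (X.beliefAt Φ lam σ t ω) ∂P := by
  have hθ := hX.measurable_theta t ht
  have hθ' : Measurable[X.past t ⊔ MeasurableSpace.comap (X.theta t) inferInstance] (X.theta t) :=
    (comap_measurable _).mono le_sup_right le_rfl
  have h1 := HasCondLaw.lintegral_eq (sup_le (hX.past_le ht.le) hθ.comap_le)
    (hX.measurable_chosen t ht) hθ' (k := oracle.linKernel Φ) (hX.chosen_law t ht)
    ((hY.mono le_sup_left le_rfl).prodMk hθ') (G := fun p => G (p.1.1, p.1.2, p.2))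
    (hG.comp (by fun_prop))
  have h2 := HasCondLaw.lintegral_eq (hX.past_le ht.le) hθ
    (X.measurable_beliefAt_past Φ lam σ t) (k := gaussianKernel d) (hX.theta_law t ht) hY
    (G := fun p => ∫⁻ A, G (p.1, p.2, A) ∂oracle.linKernel Φ p.2)
    (Measurable.lintegral_kernel_prod_right'
      (κ := (oracle.linKernel Φ).comap (Prod.snd : β × EuclideanSpace ℝ (Fin d) → _)
        measurable_snd)
      (f := fun q : (β × EuclideanSpace ℝ (Fin d)) × Finset (Fin L) => G (q.1.1, q.1.2, q.2))
      (hG.comp (by fun_prop)))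
  refine (h1.trans h2).trans (lintegral_congr fun ω => ?_)
  exact (lintegral_playKernel oracle Φ _ (g := fun x => G (Y ω, x))
    (hG.comp (measurable_const.prodMk measurable_id))).symm

theorem lintegral_noise (hX : X.IsCombLinTS P Φ lam σ oracle n) {t : ℕ} (ht : t < n) {Y : Ω → β}
    (hY : Measurable[X.past t] Y)
    {G : (β × EuclideanSpace ℝ (Fin d) × Finset (Fin L)) × (Fin L → ℝ) → ENNReal}
    (hG : Measurable G) :
    ∫⁻ ω, G ((Y ω, X.theta t ω, X.chosen t ω), X.noise Φ t ω) ∂P =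
      ∫⁻ ω, ∫⁻ η, G ((Y ω, X.theta t ω, X.chosen t ω), η) ∂noiseLaw L σ ∂P := by
  have hθ := hX.measurable_theta t ht
  have hA := hX.measurable_chosen t ht
  refine HasCondLaw.lintegral_eq (sup_le (sup_le (hX.past_le ht.le) hθ.comap_le) hA.comap_le)
    (hX.measurable_noise ht) (Z := fun _ => ()) measurable_const
    (k := Kernel.const Unit (noiseLaw L σ)) (hX.noise_law t ht)
    (Y := fun ω => (Y ω, X.theta t ω, X.chosen t ω)) ?_ hG
  refine (hY.mono (le_sup_left.trans le_sup_left) le_rfl).prodMk (Measurable.prodMk ?_ ?_)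
  · exact (comap_measurable _).mono (le_sup_right.trans le_sup_left) le_rfl
  · exact (comap_measurable _).mono le_sup_right le_rfl

/-- The joint law of everything that matters in episode `t`, given the past. -/
theorem lintegral_episode (hX : X.IsCombLinTS P Φ lam σ oracle n) {t : ℕ} (ht : t < n) {Y : Ω → β}
    (hY : Measurable[X.past t] Y)
    {G : (β × EuclideanSpace ℝ (Fin d) × Finset (Fin L)) × (Fin L → ℝ) → ENNReal}
    (hG : Measurable G) :
    ∫⁻ ω, G ((Y ω, X.theta t ω, X.chosen t ω), X.noise Φ t ω) ∂P =
      ∫⁻ ω, ∫⁻ x, ∫⁻ η, G ((Y ω, x), η) ∂noiseLaw L σ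
        ∂oracle.playKernel Φ (X.beliefAt Φ lam σ t ω) ∂P := by
  rw [hX.lintegral_noise ht hY hG]
  exact hX.lintegral_play ht hY (G := fun y => ∫⁻ η, G (y, η) ∂noiseLaw L σ)
    hG.lintegral_prod_right'

/-- Posterior sampling: given the current belief, `(θ*, A*)` is a draw of coefficients and set
from that belief. -/
theorem lintegral_posterior (hX : X.IsCombLinTS P Φ lam σ oracle n) (hlam : 0 < lam) (hσ : 0 < σ)
    {t : ℕ} (ht : t ≤ n)
    {G : (EuclideanSpace ℝ (Fin d) × Finset (Fin L)) × Belief d → ENNReal} (hG : Measurable G) :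
    ∫⁻ ω, G ((X.thetaStar ω, X.optSet ω), X.beliefAt Φ lam σ t ω) ∂P =
      ∫⁻ ω, ∫⁻ x, G (x, X.beliefAt Φ lam σ t ω)
        ∂oracle.playKernel Φ (X.beliefAt Φ lam σ t ω) ∂P := by
  induction t generalizing G with
  | zero =>
    set b₀ : Belief d := ⟨0, lam ^ 2 • 1⟩ with hb₀
    have hb : ∀ ω, X.beliefAt Φ lam σ 0 ω = b₀ := fun ω => rfl
    simp_rw [hb]
    have h1 := HasCondLaw.lintegral_eq hX.measurable_thetaStar.comap_le hX.measurable_optSet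
      (comap_measurable X.thetaStar) (k := oracle.linKernel Φ) hX.optSet_law
      (comap_measurable X.thetaStar) (G := fun p => G (p, b₀))
      (hG.comp (measurable_id.prodMk measurable_const))
    have hm : Measurable fun θ => ∫⁻ A, G ((θ, A), b₀) ∂oracle.linKernel Φ θ :=
      Measurable.lintegral_kernel_prod_right' (κ := oracle.linKernel Φ)
        (f := fun q => G (q, b₀)) (hG.comp (measurable_id.prodMk measurable_const))
    have h2 : ∫⁻ ω, ∫⁻ A, G ((X.thetaStar ω, A), b₀) ∂oracle.linKernel Φ (X.thetaStar ω) ∂P =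
        ∫⁻ θ, ∫⁻ A, G ((θ, A), b₀) ∂oracle.linKernel Φ θ ∂gaussianKernel d b₀ := by
      rw [gaussianKernel_apply, hb₀, ← hb₀]
      have := lintegral_map (μ := P) hm hX.measurable_thetaStar
      rw [hX.prior] at this
      exact this.symm
    rw [lintegral_const, measure_univ, mul_one]
    exact (h1.trans h2).trans (lintegral_playKernel oracle Φ b₀ (g := fun x => G (x, b₀))
      (hG.comp (measurable_id.prodMk measurable_const))).symm
  | succ t ih =>
    have ht' : t < n := ht
    have hY : Measurable[X.past t] fun ω =>
        ((X.thetaStar ω, X.optSet ω), X.beliefAt Φ lam σ t ω) :=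
      ((X.measurable_thetaStar_past t).prodMk (X.measurable_optSet_past t)).prodMk
        (X.measurable_beliefAt_past Φ lam σ t)
    set U : ((((EuclideanSpace ℝ (Fin d) × Finset (Fin L)) × Belief d) ×
      EuclideanSpace ℝ (Fin d) × Finset (Fin L)) × (Fin L → ℝ)) → Belief d :=
      fun q => kalmanUpdate Φ σ q.1.1.2 q.1.2.2 (linWeight Φ q.1.1.1.1 + q.2) with hU
    have hUm : Measurable U :=
      measurable_kalmanUpdate Φ σ (by fun_prop) (by fun_prop)
        (((measurable_linWeight Φ).comp (by fun_prop)).add measurable_snd)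
    have hb : ∀ ω, X.beliefAt Φ lam σ (t + 1) ω =
        U ((((X.thetaStar ω, X.optSet ω), X.beliefAt Φ lam σ t ω), X.theta t ω, X.chosen t ω),
          X.noise Φ t ω) := fun ω => by
      simp only [hU, Run.noise, add_sub_cancel]
      rfl
    -- By induction `(θ*, A*)` is a draw `x` from the belief at time `t`, while `x' = (θ_t, A^t)` is
    -- another draw using that belief only. Fubini moves `x'` outside, so that Bayes' rule for one
    -- episode can be applied with the chosen set fixed.
    have key : ∀ F : (EuclideanSpace ℝ (Fin d) × Finset (Fin L)) × Belief d → ENNReal,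
        Measurable F → ∫⁻ ω, F ((X.thetaStar ω, X.optSet ω), X.beliefAt Φ lam σ (t + 1) ω) ∂P =
          ∫⁻ ω, ∫⁻ x', ∫⁻ x, ∫⁻ η, F (x, kalmanUpdate Φ σ (X.beliefAt Φ lam σ t ω) x'.2
            (linWeight Φ x.1 + η)) ∂noiseLaw L σ
            ∂oracle.playKernel Φ (X.beliefAt Φ lam σ t ω)
            ∂oracle.playKernel Φ (X.beliefAt Φ lam σ t ω) ∂P := by
      intro F hF
      have hFU : Measurable fun q => F (q.1.1.1, U q) := hF.comp ((by fun_prop :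
        Measurable fun q : ((((EuclideanSpace ℝ (Fin d) × Finset (Fin L)) × Belief d) ×
          EuclideanSpace ℝ (Fin d) × Finset (Fin L)) × (Fin L → ℝ)) => q.1.1.1).prodMk hUm)
      simp_rw [hb]
      rw [hX.lintegral_episode ht' hY (G := fun q => F (q.1.1.1, U q)) hFU]
      have hI : Measurable fun p : ((EuclideanSpace ℝ (Fin d) × Finset (Fin L)) × Belief d) ×
          EuclideanSpace ℝ (Fin d) × Finset (Fin L) =>
          ∫⁻ η, F (p.1.1, U (p, η)) ∂noiseLaw L σ := hFU.lintegral_prod_right'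
      have hJ : Measurable fun p : (EuclideanSpace ℝ (Fin d) × Finset (Fin L)) × Belief d =>
          ∫⁻ x', ∫⁻ η, F (p.1, U ((p, x'), η)) ∂noiseLaw L σ ∂oracle.playKernel Φ p.2 :=
        Measurable.lintegral_kernel_prod_right'
          (κ := (oracle.playKernel Φ).comap
            (Prod.snd : (EuclideanSpace ℝ (Fin d) × Finset (Fin L)) × Belief d → _)
            measurable_snd) hI
      rw [ih ht'.le hJ]
      refine lintegral_congr fun ω => ?_
      refine lintegral_lintegral_swap (μ := oracle.playKernel Φ (X.beliefAt Φ lam σ t ω))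
        (ν := oracle.playKernel Φ (X.beliefAt Φ lam σ t ω)) (f := fun x x' => ∫⁻ η, F (x, U
        (((x, X.beliefAt Φ lam σ t ω), x'), η)) ∂noiseLaw L σ) ?_
      exact (hI.comp (by fun_prop :
        Measurable fun q : (EuclideanSpace ℝ (Fin d) × Finset (Fin L)) ×
          EuclideanSpace ℝ (Fin d) × Finset (Fin L) =>
            ((q.1, X.beliefAt Φ lam σ t ω), q.2))).aemeasurable
    have hH : Measurable fun b' : Belief d => ∫⁻ x', G (x', b') ∂oracle.playKernel Φ b' :=
      Measurable.lintegral_kernel_prod_right (κ := oracle.playKernel Φ)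
        (f := fun b' x => G (x, b')) (hG.comp measurable_swap)
    refine (key G hG).trans (Eq.trans ?_ (key (fun p => ∫⁻ x', G (x', p.2)
      ∂oracle.playKernel Φ p.2) (hH.comp measurable_snd)).symm)
    exact lintegral_congr fun ω => lintegral_congr fun x' =>
      lintegral_playKernel_kalmanUpdate oracle Φ hσ (X.posDef_beliefAt_cov Φ hlam hσ t ω) x'.2 hG

end IsCombLinTS

end Run

/-! ### Symmetric laws and sums over random sets. -/

section Symmetry

variable {Ω : Type*} [MeasurableSpace Ω] {P : Measure Ω} {L d : ℕ}

/-- `f` and `-f` have the same law. Integrability is not needed, since a non-integrable function has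
integral `0` by default. -/
theorem integral_eq_zero_of_lintegral_neg {f : Ω → ℝ} (hf : Measurable f)
    (h : ∀ G : ℝ → ENNReal, Measurable G → ∫⁻ ω, G (f ω) ∂P = ∫⁻ ω, G (-f ω) ∂P) :
    ∫ ω, f ω ∂P = 0 := by
  have hneg : Measurable fun ω => -f ω := hf.neg
  have hmap : P.map f = P.map fun ω => -f ω := by
    refine Measure.ext_of_lintegral _ fun G hG => ?_
    rw [lintegral_map hG hf, lintegral_map hG hneg, h G hG]
  have h1 : ∫ ω, f ω ∂P = ∫ ω, -f ω ∂P := by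
    have := integral_map (μ := P) hf.aemeasurable (f := fun x : ℝ => x) (by fun_prop)
    have h2 := integral_map (μ := P) hneg.aemeasurable (f := fun x : ℝ => x) (by fun_prop)
    rw [← this, hmap]
    exact h2
  rw [integral_neg] at h1
  linarith

theorem lintegral_noiseLaw_neg (σ : ℝ) {G : (Fin L → ℝ) → ENNReal} (hG : Measurable G) :
    ∫⁻ η, G (-η) ∂noiseLaw L σ = ∫⁻ η, G η ∂noiseLaw L σ := by
  have h : MeasurePreserving (fun η : Fin L → ℝ => -η) (noiseLaw L σ) (noiseLaw L σ) := by
    unfold noiseLaw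
    exact measurePreserving_pi _ _ (f := fun _ : Fin L => fun x : ℝ => -x) fun _ =>
      ⟨measurable_neg, by simp [gaussianReal_map_neg]⟩
  exact h.lintegral_comp hG

theorem integrable_eval_noiseLaw (σ : ℝ) (e : Fin L) :
    Integrable (fun η : Fin L → ℝ => η e) (noiseLaw L σ) :=
  (measurePreserving_eval (fun _ : Fin L => gaussianReal 0 (σ ^ 2).toNNReal)
    e).integrable_comp_of_integrable IsGaussian.integrable_id

open scoped MatrixOrder in
theorem lintegral_gaussianKernel_sub_mean_neg (b : Belief d)
    {G : (Fin d → ℝ) → ENNReal} (hG : Measurable G) :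
    ∫⁻ θ, G (-(θ.ofLp - b.mean)) ∂gaussianKernel d b =
      ∫⁻ θ, G (θ.ofLp - b.mean) ∂gaussianKernel d b := by
  have hm : Measurable fun θ : EuclideanSpace ℝ (Fin d) => θ.ofLp - b.mean := by fun_prop
  rw [lintegral_gaussianKernel b (g := fun θ => G (-(θ.ofLp - b.mean))) (hG.comp hm.neg),
    lintegral_gaussianKernel b (g := fun θ => G (θ.ofLp - b.mean)) (hG.comp hm)]
  have h := stdGaussian_map (LinearIsometryEquiv.neg ℝ (E := EuclideanSpace ℝ (Fin d)))
  conv_rhs => rw [← h]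
  have hk : Measurable fun z => G ((WithLp.toLp 2 b.mean +
      toEuclideanCLM (𝕜 := ℝ) (CFC.sqrt b.cov) z).ofLp - b.mean) := hG.comp (by fun_prop)
  rw [lintegral_map hk (by fun_prop)]
  refine lintegral_congr fun z => ?_
  simp

/-- A crude first moment, the overshoot bound at `c = 0` used for both signs; it serves only
integrability. -/
theorem lintegral_enorm_dotProduct_sub_mean_le {b : Belief d} (hb : b.cov.PosDef)
    (φ : Fin d → ℝ) :
    ∫⁻ θ, ‖φ ⬝ᵥ (θ.ofLp - b.mean)‖ₑ ∂gaussianKernel d b ≤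
      2 * ENNReal.ofReal (√(φ ⬝ᵥ b.cov *ᵥ φ)) := by
  have h1 := lintegral_ofReal_dotProduct_sub_le hb φ le_rfl
  simp only [zero_mul, sub_zero] at h1
  have hle : ENNReal.ofReal (√(φ ⬝ᵥ b.cov *ᵥ φ) * (Real.exp (-0 ^ 2 / 2) / √(2 * Real.pi))) ≤
      ENNReal.ofReal (√(φ ⬝ᵥ b.cov *ᵥ φ)) := by
    refine ENNReal.ofReal_le_ofReal (mul_le_of_le_one_right (Real.sqrt_nonneg _) ?_)
    rw [div_le_one (by positivity)]
    simp only [ne_eq, OfNat.ofNat_ne_zero, not_false_eq_true, zero_pow, neg_zero, zero_div,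
      Real.exp_zero]
    exact Real.one_le_sqrt.2 (by nlinarith [Real.pi_gt_three])
  have h2 : ∫⁻ θ, ENNReal.ofReal (-(φ ⬝ᵥ (θ.ofLp - b.mean))) ∂gaussianKernel d b =
      ∫⁻ θ, ENNReal.ofReal (φ ⬝ᵥ (θ.ofLp - b.mean)) ∂gaussianKernel d b := by
    simp_rw [← dotProduct_neg]
    exact lintegral_gaussianKernel_sub_mean_neg b (G := fun v => ENNReal.ofReal (φ ⬝ᵥ v))
      (by fun_prop)
  calc _ ≤ ∫⁻ θ, (ENNReal.ofReal (φ ⬝ᵥ (θ.ofLp - b.mean)) +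
        ENNReal.ofReal (-(φ ⬝ᵥ (θ.ofLp - b.mean)))) ∂gaussianKernel d b := by
        refine lintegral_mono fun θ => ?_
        rw [Real.enorm_eq_ofReal_abs]
        rcases abs_cases (φ ⬝ᵥ (θ.ofLp - b.mean)) with ⟨h, _⟩ | ⟨h, _⟩
        · rw [h]; exact le_self_add
        · rw [h]; exact le_add_self
    _ = _ + _ := by rw [lintegral_add_left (by fun_prop), h2]
    _ ≤ _ := add_le_add (h1.trans hle) (h1.trans hle)
    _ = _ := (two_mul _).symm

theorem integrable_sum_mem {A : Ω → Finset (Fin L)} (hA : Measurable A) {h : Fin L → Ω → ℝ}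
    (hh : ∀ e, Integrable (h e) P) : Integrable (fun ω => ∑ e ∈ A ω, h e ω) P := by
  have heq : (fun ω => ∑ e ∈ A ω, h e ω) =
      fun ω => ∑ e, Set.indicator {ω | e ∈ A ω} (h e) ω := by
    funext ω
    simp [Set.indicator_apply, Finset.sum_ite_mem]
  rw [heq]
  exact integrable_finsetSum _ fun e _ => (hh e).indicator
    (hA (measurableSet_mem_finset e))

theorem measurable_sum_mem {A : Ω → Finset (Fin L)} (hA : Measurable A) {h : Fin L → Ω → ℝ}
    (hh : ∀ e, Measurable (h e)) : Measurable (fun ω => ∑ e ∈ A ω, h e ω) := by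
  have heq : (fun ω => ∑ e ∈ A ω, h e ω) =
      fun ω => ∑ e, Set.indicator {ω | e ∈ A ω} (h e) ω := by
    funext ω
    simp [Set.indicator_apply, Finset.sum_ite_mem]
  rw [heq]
  exact Finset.measurable_sum _ fun e _ => (hh e).indicator
    (hA (measurableSet_mem_finset e))

theorem integral_le_of_lintegral_ofReal_le {f : Ω → ℝ} (hf : Integrable f P) {ε : ℝ} (hε : 0 ≤ ε)
    (h : ∫⁻ ω, ENNReal.ofReal (f ω) ∂P ≤ ENNReal.ofReal ε) : ∫ ω, f ω ∂P ≤ ε := by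
  rw [integral_eq_lintegral_pos_part_sub_lintegral_neg_part hf]
  have := ENNReal.toReal_mono ENNReal.ofReal_ne_top h
  rw [ENNReal.toReal_ofReal hε] at this
  linarith [ENNReal.toReal_nonneg (a := ∫⁻ ω, ENNReal.ofReal (-f ω) ∂P)]

end Symmetry

/-! ### Overshoot above the confidence bounds. -/

section Excess

variable {L d : ℕ} {𝒜 : Finset (Finset (Fin L))}

/-- The posterior standard deviation of the weight of item `e`. -/
noncomputable def width (Φ : Matrix (Fin L) (Fin d) ℝ) (b : Belief d) (e : Fin L) : ℝ :=
  √(Φ e ⬝ᵥ b.cov *ᵥ Φ e)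

theorem width_nonneg (Φ : Matrix (Fin L) (Fin d) ℝ) (b : Belief d) (e : Fin L) :
    0 ≤ width Φ b e := Real.sqrt_nonneg _

theorem measurable_width (Φ : Matrix (Fin L) (Fin d) ℝ) (e : Fin L) :
    Measurable fun b : Belief d => width Φ b e := by
  have h := fun i j => measurable_belief_cov (d := d) i j
  simp only [width, dotProduct, mulVec]
  fun_prop

/-- How much the weights of the items of `A` exceed their upper confidence bounds. -/
noncomputable def excess (Φ : Matrix (Fin L) (Fin d) ℝ) (c : ℝ) (b : Belief d)
    (x : EuclideanSpace ℝ (Fin d) × Finset (Fin L)) : ℝ :=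
  ∑ e ∈ x.2, (Φ e ⬝ᵥ (x.1.ofLp - b.mean) - c * width Φ b e)

theorem measurable_excess (Φ : Matrix (Fin L) (Fin d) ℝ) (c : ℝ) :
    Measurable fun p : Belief d × EuclideanSpace ℝ (Fin d) × Finset (Fin L) =>
      excess Φ c p.1 p.2 := by
  refine measurable_sum_mem (A := fun p : Belief d × EuclideanSpace ℝ (Fin d) × Finset (Fin L) =>
    p.2.2) (by fun_prop) (h := fun e p => Φ e ⬝ᵥ (p.2.1.ofLp - p.1.mean) - c * width Φ p.1 e)
    fun e => ?_
  have h1 := measurable_belief_mean (d := d)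
  have h2 := measurable_width (d := d) Φ e
  fun_prop

/-- The set depends on `θ`. Bounding the positive part of the sum by the positive parts over all `L`
items removes that dependence, and single-item tails suffice. -/
theorem lintegral_excess_le_card (oracle : Oracle L 𝒜) (Φ : Matrix (Fin L) (Fin d) ℝ)
    {b : Belief d} (hb : b.cov.PosDef) {lam c : ℝ} (hc : 0 ≤ c)
    (hs : ∀ e, width Φ b e ≤ lam) :
    ∫⁻ x, ENNReal.ofReal (excess Φ c b x) ∂oracle.playKernel Φ b ≤
      ENNReal.ofReal (L * lam * (Real.exp (-c ^ 2 / 2) / √(2 * Real.pi))) := by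
  have hm : Measurable fun x : EuclideanSpace ℝ (Fin d) × Finset (Fin L) =>
      ∑ e, ENNReal.ofReal (Φ e ⬝ᵥ (x.1.ofLp - b.mean) - c * width Φ b e) := by fun_prop
  calc _ ≤ ∫⁻ x : EuclideanSpace ℝ (Fin d) × Finset (Fin L),
        ∑ e, ENNReal.ofReal (Φ e ⬝ᵥ (x.1.ofLp - b.mean) - c * width Φ b e)
          ∂oracle.playKernel Φ b := by
        refine lintegral_mono fun x => ?_
        refine (Finset.le_sum_of_subadditive (ENNReal.ofReal) ENNReal.ofReal_zero.le
          (fun _ _ => ENNReal.ofReal_add_le) _ _).trans ?_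
        exact Finset.sum_le_sum_of_subset (Finset.subset_univ _)
    _ = ∑ e, ∫⁻ θ, ENNReal.ofReal (Φ e ⬝ᵥ (θ.ofLp - b.mean) - c * width Φ b e)
          ∂gaussianKernel d b := by
        rw [lintegral_playKernel oracle Φ b hm]
        simp only [lintegral_const, measure_univ, mul_one]
        exact lintegral_finsetSum _ (by fun_prop)
    _ ≤ ∑ _e : Fin L, ENNReal.ofReal (lam * (Real.exp (-c ^ 2 / 2) / √(2 * Real.pi))) := by
        refine Finset.sum_le_sum fun e _ => ?_
        refine (lintegral_ofReal_dotProduct_sub_le hb (Φ e) hc).trans ?_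
        exact ENNReal.ofReal_le_ofReal (mul_le_mul_of_nonneg_right (hs e) (by positivity))
    _ = _ := by
        rw [Finset.sum_const, Finset.card_univ, Fintype.card_fin, nsmul_eq_mul, mul_assoc,
          ENNReal.ofReal_mul (Nat.cast_nonneg L), ENNReal.ofReal_natCast]

theorem ae_mem_linKernel (oracle : Oracle L 𝒜) (Φ : Matrix (Fin L) (Fin d) ℝ)
    (θ : EuclideanSpace ℝ (Fin d)) : ∀ᵐ A ∂oracle.linKernel Φ θ, A ∈ 𝒜 :=
  oracle.feasible (linWeight Φ θ)

/-- With `r` the norm of the underlying Gaussian vector, every item overshoots by at most its width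
times `r - c`, simultaneously. Hence the choice of the set is harmless, and `L` is replaced by `K`
and the dimension. -/
theorem lintegral_excess_le_dim (oracle : Oracle L 𝒜) {K : ℕ} (hK : ∀ A ∈ 𝒜, A.card ≤ K)
    (Φ : Matrix (Fin L) (Fin d) ℝ)
    {b : Belief d} (hb : b.cov.PosDef) {lam c : ℝ} (hlam : 0 ≤ lam) (hc : 0 ≤ c)
    (hs : ∀ e, width Φ b e ≤ lam) :
    ∫⁻ x, ENNReal.ofReal (excess Φ c b x) ∂oracle.playKernel Φ b ≤
      ENNReal.ofReal (K * lam * (2 * d * (Real.exp (-c ^ 2 / (2 * d)) / √(2 * Real.pi)))) := by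
  have hm : Measurable fun x : EuclideanSpace ℝ (Fin d) × Finset (Fin L) =>
      ENNReal.ofReal (excess Φ c b x) :=
    ((measurable_excess Φ c).comp (measurable_const.prodMk measurable_id)).ennreal_ofReal
  rw [lintegral_playKernel oracle Φ b hm]
  refine lintegral_gaussianKernel_le_of_forall hb
    (Measurable.lintegral_kernel_prod_right' (κ := oracle.linKernel Φ) hm) (by positivity) hc
    fun θ r hr => ?_
  calc ∫⁻ A, ENNReal.ofReal (excess Φ c b (θ, A)) ∂oracle.linKernel Φ θ
      ≤ ∫⁻ _A, ENNReal.ofReal (K * lam * (r - c)) ∂oracle.linKernel Φ θ := by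
        refine lintegral_mono_ae ?_
        filter_upwards [ae_mem_linKernel oracle Φ θ] with A hA
        have hle : excess Φ c b (θ, A) ≤ ∑ e ∈ A, width Φ b e * (r - c) := by
          refine Finset.sum_le_sum fun e _ => ?_
          have := hr (Φ e)
          change _ ≤ width Φ b e * r at this
          linarith
        -- The widths may be enlarged to `λ` only if `r ≥ c`; otherwise the excess is nonpositive.
        rcases le_total c r with hcr | hcr
        · refine ENNReal.ofReal_le_ofReal (hle.trans ?_)
          rw [← Finset.sum_mul]
          refine mul_le_mul_of_nonneg_right ?_ (sub_nonneg.2 hcr)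
          calc _ ≤ A.card • lam := Finset.sum_le_card_nsmul _ _ _ fun e _ => hs e
            _ ≤ K * lam := by
              rw [nsmul_eq_mul]
              exact mul_le_mul_of_nonneg_right (by exact_mod_cast hK A hA) hlam
        · rw [ENNReal.ofReal_of_nonpos]
          · exact zero_le
          · exact hle.trans (Finset.sum_nonpos fun e _ =>
              mul_nonpos_of_nonneg_of_nonpos (width_nonneg _ _ _) (by linarith))
    _ = _ := by simp

end Excess
theorem Run.width_beliefAt_le {Ω : Type*} {L d : ℕ} {Φ : Matrix (Fin L) (Fin d) ℝ} {lam σ : ℝ}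
    (X : Run Ω L d) (hlam : 0 < lam) (hσ : 0 < σ)
    (hΦ : ∀ e, ‖feature Φ e‖ ≤ 1) (t : ℕ) (ω : Ω) (e : Fin L) :
    width Φ (X.beliefAt Φ lam σ t ω) e ≤ lam := by
  rw [width, Run.beliefAt, belief_cov Φ _ hlam hσ]
  exact Real.sqrt_le_iff.2 ⟨hlam.le, quadForm_precision_inv_le Φ _ hlam t (hΦ e)⟩

/-! ### Integrability, regret decomposition and summation over episodes. -/

namespace Run.IsCombLinTS

variable {Ω : Type*} [mΩ : MeasurableSpace Ω] {L d : ℕ} {P : Measure Ω}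
  {Φ : Matrix (Fin L) (Fin d) ℝ} {lam σ : ℝ} {𝒜 : Finset (Finset (Fin L))} {oracle : Oracle L 𝒜}
  {n : ℕ} {X : Run Ω L d}

theorem measurable_deviation (hX : X.IsCombLinTS P Φ lam σ oracle n) {t : ℕ} (ht : t ≤ n)
    (e : Fin L) : Measurable fun ω =>
      Φ e ⬝ᵥ ((X.thetaStar ω).ofLp - (X.beliefAt Φ lam σ t ω).mean) := by
  have h1 := hX.measurable_thetaStar
  have h2 := measurable_belief_mean.comp (hX.measurable_beliefAt ht)
  simp only [Function.comp_def] at h2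
  fun_prop

variable [IsProbabilityMeasure P]

theorem integrable_width (hX : X.IsCombLinTS P Φ lam σ oracle n) (hlam : 0 < lam) (hσ : 0 < σ)
    (hΦ : ∀ e, ‖feature Φ e‖ ≤ 1) {t : ℕ} (ht : t ≤ n) (e : Fin L) :
    Integrable (fun ω => width Φ (X.beliefAt Φ lam σ t ω) e) P := by
  refine Integrable.of_bound
    ((measurable_width Φ e).comp (hX.measurable_beliefAt ht)).aestronglyMeasurable lam
    (Filter.Eventually.of_forall fun ω => ?_)
  rw [Real.norm_of_nonneg (width_nonneg _ _ _)]
  exact X.width_beliefAt_le hlam hσ hΦ t ω e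

theorem integrable_deviation (hX : X.IsCombLinTS P Φ lam σ oracle n) (hlam : 0 < lam)
    (hσ : 0 < σ) (hΦ : ∀ e, ‖feature Φ e‖ ≤ 1) {t : ℕ} (ht : t ≤ n) (e : Fin L) :
    Integrable (fun ω =>
      Φ e ⬝ᵥ ((X.thetaStar ω).ofLp - (X.beliefAt Φ lam σ t ω).mean)) P := by
  refine ⟨(hX.measurable_deviation ht e).aestronglyMeasurable, ?_⟩
  have hm := measurable_belief_mean (d := d)
  have hG : Measurable fun p : (EuclideanSpace ℝ (Fin d) × Finset (Fin L)) × Belief d =>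
      ‖Φ e ⬝ᵥ (p.1.1.ofLp - p.2.mean)‖ₑ := by
    simp only [dotProduct]
    fun_prop
  rw [HasFiniteIntegral, hX.lintegral_posterior hlam hσ ht hG]
  have hbound : ∀ ω, ∫⁻ x, ‖Φ e ⬝ᵥ (x.1.ofLp - (X.beliefAt Φ lam σ t ω).mean)‖ₑ
      ∂oracle.playKernel Φ (X.beliefAt Φ lam σ t ω) ≤ 2 * ENNReal.ofReal lam := by
    intro ω
    rw [lintegral_playKernel oracle Φ _ (by simp only [dotProduct]; fun_prop)]
    simp only [lintegral_const, measure_univ, mul_one]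
    refine (lintegral_enorm_dotProduct_sub_mean_le
      (X.posDef_beliefAt_cov Φ hlam hσ t ω) (Φ e)).trans ?_
    gcongr
    exact X.width_beliefAt_le hlam hσ hΦ t ω e
  refine (lintegral_mono hbound).trans_lt ?_
  simp [ENNReal.mul_lt_top]

theorem integrable_dotProduct_thetaStar (hX : X.IsCombLinTS P Φ lam σ oracle n) (hlam : 0 < lam)
    (hσ : 0 < σ) (hΦ : ∀ e, ‖feature Φ e‖ ≤ 1) (e : Fin L) :
    Integrable (fun ω => Φ e ⬝ᵥ (X.thetaStar ω).ofLp) P := by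
  -- At time `0` the mean is zero, so the deviation is the weight itself.
  have h := hX.integrable_deviation hlam hσ hΦ (Nat.zero_le n) e
  simpa [beliefAt, belief] using h

theorem integrable_dotProduct_mean (hX : X.IsCombLinTS P Φ lam σ oracle n) (hlam : 0 < lam)
    (hσ : 0 < σ) (hΦ : ∀ e, ‖feature Φ e‖ ≤ 1) {t : ℕ} (ht : t ≤ n) (e : Fin L) :
    Integrable (fun ω => Φ e ⬝ᵥ (X.beliefAt Φ lam σ t ω).mean) P := by
  refine ((hX.integrable_dotProduct_thetaStar hlam hσ hΦ e).sub
    (hX.integrable_deviation hlam hσ hΦ ht e)).congr (Filter.Eventually.of_forall fun ω => ?_)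
  simp only [Pi.sub_apply, dotProduct_sub]
  ring

theorem integrable_noise (hX : X.IsCombLinTS P Φ lam σ oracle n) {t : ℕ} (ht : t < n)
    (e : Fin L) : Integrable (fun ω => X.noise Φ t ω e) P := by
  refine ⟨((measurable_pi_apply e).comp (hX.measurable_noise ht)).aestronglyMeasurable, ?_⟩
  have h := hX.lintegral_noise ht (Y := fun _ => ()) measurable_const
    (G := fun q => ‖q.2 e‖ₑ) (by fun_prop)
  rw [HasFiniteIntegral, h]
  simpa [HasFiniteIntegral] using (integrable_eval_noiseLaw σ e).2

/-- The noise does not contribute to the expected weight of a set chosen before it is drawn. -/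
theorem integral_sum_noise_eq_zero (hX : X.IsCombLinTS P Φ lam σ oracle n) {t : ℕ} (ht : t < n)
    {Y : Ω → Finset (Fin L)} (hY : Measurable[X.past t] Y)
    {S : Finset (Fin L) × Finset (Fin L) → Finset (Fin L)} (hS : Measurable S) :
    ∫ ω, ∑ e ∈ S (Y ω, X.chosen t ω), X.noise Φ t ω e ∂P = 0 := by
  have hSm : Measurable fun ω => S (Y ω, X.chosen t ω) :=
    hS.comp ((hY.mono (hX.past_le ht.le) le_rfl).prodMk (hX.measurable_chosen t ht))
  have hm : Measurable fun q : (Finset (Fin L) × EuclideanSpace ℝ (Fin d) × Finset (Fin L)) ×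
      (Fin L → ℝ) => ∑ e ∈ S (q.1.1, q.1.2.2), q.2 e :=
    measurable_sum_mem (A := fun q : (Finset (Fin L) × EuclideanSpace ℝ (Fin d) ×
      Finset (Fin L)) × (Fin L → ℝ) => S (q.1.1, q.1.2.2)) (hS.comp (by fun_prop))
      (h := fun e q => q.2 e) (by fun_prop)
  refine integral_eq_zero_of_lintegral_neg (measurable_sum_mem hSm fun e =>
    (measurable_pi_apply e).comp (hX.measurable_noise ht)) fun G hG => ?_
  have h1 := hX.lintegral_noise ht hY (G := fun q => G (∑ e ∈ S (q.1.1, q.1.2.2), q.2 e))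
    (hG.comp hm)
  have h2 := hX.lintegral_noise ht hY (G := fun q => G (-∑ e ∈ S (q.1.1, q.1.2.2), q.2 e))
    (hG.comp hm.neg)
  refine h1.trans (Eq.trans (lintegral_congr fun ω => ?_) h2.symm)
  have hmS : Measurable fun η : Fin L → ℝ => ∑ e ∈ S (Y ω, X.chosen t ω), η e := by fun_prop
  refine (lintegral_noiseLaw_neg σ (G := fun η => G (∑ e ∈ S (Y ω, X.chosen t ω), η e))
    (hG.comp hmS)).symm.trans ?_
  simp

/-- Given the current belief, `θ*` and the chosen set are independent, and `θ*` is a draw from that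
belief. -/
theorem lintegral_thetaStar_chosen (hX : X.IsCombLinTS P Φ lam σ oracle n) (hlam : 0 < lam)
    (hσ : 0 < σ) {t : ℕ} (ht : t < n)
    {G : (EuclideanSpace ℝ (Fin d) × Belief d) × Finset (Fin L) → ENNReal} (hG : Measurable G) :
    ∫⁻ ω, G ((X.thetaStar ω, X.beliefAt Φ lam σ t ω), X.chosen t ω) ∂P =
      ∫⁻ ω, ∫⁻ x, ∫⁻ θ, G ((θ, X.beliefAt Φ lam σ t ω), x.2)
        ∂gaussianKernel d (X.beliefAt Φ lam σ t ω)
        ∂oracle.playKernel Φ (X.beliefAt Φ lam σ t ω) ∂P := by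
  have hY : Measurable[X.past t] fun ω => (X.thetaStar ω, X.beliefAt Φ lam σ t ω) :=
    (X.measurable_thetaStar_past t).prodMk (X.measurable_beliefAt_past Φ lam σ t)
  have hGm : Measurable fun q : (EuclideanSpace ℝ (Fin d) × Belief d) ×
      EuclideanSpace ℝ (Fin d) × Finset (Fin L) => G (q.1, q.2.2) := hG.comp (by fun_prop)
  have h1 := hX.lintegral_play ht hY (G := fun q => G (q.1, q.2.2)) hGm
  have hJ : Measurable fun p : EuclideanSpace ℝ (Fin d) × Belief d =>
      ∫⁻ x, G (p, x.2) ∂oracle.playKernel Φ p.2 :=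
    Measurable.lintegral_kernel_prod_right'
      (κ := (oracle.playKernel Φ).comap (Prod.snd : EuclideanSpace ℝ (Fin d) × Belief d → _)
        measurable_snd) (f := fun q => G (q.1, q.2.2)) hGm
  have h2 := hX.lintegral_posterior hlam hσ ht.le
    (G := fun q => ∫⁻ x, G ((q.1.1, q.2), x.2) ∂oracle.playKernel Φ q.2)
    (hJ.comp ((measurable_fst.comp measurable_fst).prodMk measurable_snd))
  refine h1.trans (h2.trans (lintegral_congr fun ω => ?_))
  generalize X.beliefAt Φ lam σ t ω = b
  have hpair : Measurable fun q : EuclideanSpace ℝ (Fin d) ×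
      EuclideanSpace ℝ (Fin d) × Finset (Fin L) => G ((q.1, b), q.2.2) := hG.comp (by fun_prop)
  have hJb : Measurable fun y : EuclideanSpace ℝ (Fin d) × Finset (Fin L) =>
      ∫⁻ x, G ((y.1, b), x.2) ∂oracle.playKernel Φ b :=
    (Measurable.lintegral_prod_right' (ν := oracle.playKernel Φ b) hpair).comp measurable_fst
  rw [lintegral_playKernel oracle Φ b (g := fun y => ∫⁻ x, G ((y.1, b), x.2)
    ∂oracle.playKernel Φ b) hJb]
  simp only [lintegral_const, measure_univ, mul_one]
  exact lintegral_lintegral_swap (μ := gaussianKernel d b) (ν := oracle.playKernel Φ b)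
    (f := fun θ x => G ((θ, b), x.2)) hpair.aemeasurable

/-- The chosen set is conditionally independent of `θ*`, whose posterior mean is `θ̄_t`. -/
theorem integral_sum_deviation_eq_zero (hX : X.IsCombLinTS P Φ lam σ oracle n) (hlam : 0 < lam)
    (hσ : 0 < σ) {t : ℕ} (ht : t < n) :
    ∫ ω, ∑ e ∈ X.chosen t ω, Φ e ⬝ᵥ ((X.thetaStar ω).ofLp - (X.beliefAt Φ lam σ t ω).mean) ∂P
      = 0 := by
  have hmean := measurable_belief_mean (d := d)
  have hm : Measurable fun q : (EuclideanSpace ℝ (Fin d) × Belief d) × Finset (Fin L) =>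
      ∑ e ∈ q.2, Φ e ⬝ᵥ (q.1.1.ofLp - q.1.2.mean) :=
    measurable_sum_mem (A := fun q : (EuclideanSpace ℝ (Fin d) × Belief d) × Finset (Fin L) => q.2)
      measurable_snd (h := fun e q => Φ e ⬝ᵥ (q.1.1.ofLp - q.1.2.mean))
      fun e => by simp only [dotProduct]; fun_prop
  refine integral_eq_zero_of_lintegral_neg (measurable_sum_mem (hX.measurable_chosen t ht)
    fun e => hX.measurable_deviation ht.le e) fun G hG => ?_
  refine (hX.lintegral_thetaStar_chosen hlam hσ ht
    (G := fun q => G (∑ e ∈ q.2, Φ e ⬝ᵥ (q.1.1.ofLp - q.1.2.mean))) (hG.comp hm)).trans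
    (Eq.trans ?_ (hX.lintegral_thetaStar_chosen hlam hσ ht
      (G := fun q => G (-∑ e ∈ q.2, Φ e ⬝ᵥ (q.1.1.ofLp - q.1.2.mean))) (hG.comp hm.neg)).symm)
  refine lintegral_congr fun ω => lintegral_congr fun x => ?_
  have hv : Measurable fun v : Fin d → ℝ => ∑ e ∈ x.2, Φ e ⬝ᵥ v := by
    simp only [dotProduct]; fun_prop
  refine (lintegral_gaussianKernel_sub_mean_neg (X.beliefAt Φ lam σ t ω)
    (G := fun v => G (∑ e ∈ x.2, Φ e ⬝ᵥ v)) (hG.comp hv)).symm.trans ?_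
  simp only [dotProduct_neg, Finset.sum_neg_distrib]

/-- Given the current belief, the benchmark set and the chosen set have the same law. -/
theorem integral_optSet_eq_integral_chosen (hX : X.IsCombLinTS P Φ lam σ oracle n)
    (hlam : 0 < lam) (hσ : 0 < σ) {t : ℕ} (ht : t < n) {g : Belief d × Finset (Fin L) → ℝ}
    (hg : Measurable g) :
    ∫ ω, g (X.beliefAt Φ lam σ t ω, X.optSet ω) ∂P =
      ∫ ω, g (X.beliefAt Φ lam σ t ω, X.chosen t ω) ∂P := by
  have h1 : Measurable fun ω => (X.beliefAt Φ lam σ t ω, X.optSet ω) :=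
    (hX.measurable_beliefAt ht.le).prodMk hX.measurable_optSet
  have h2 : Measurable fun ω => (X.beliefAt Φ lam σ t ω, X.chosen t ω) :=
    (hX.measurable_beliefAt ht.le).prodMk (hX.measurable_chosen t ht)
  have hmap : P.map (fun ω => (X.beliefAt Φ lam σ t ω, X.optSet ω)) =
      P.map fun ω => (X.beliefAt Φ lam σ t ω, X.chosen t ω) := by
    refine Measure.ext_of_lintegral _ fun G hG => ?_
    rw [lintegral_map hG h1, lintegral_map hG h2]
    refine (hX.lintegral_posterior hlam hσ ht.le (G := fun p => G (p.2, p.1.2))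
      (hG.comp (by fun_prop))).trans ?_
    exact (hX.lintegral_play ht (X.measurable_beliefAt_past Φ lam σ t)
      (G := fun p => G (p.1, p.2.2)) (hG.comp (by fun_prop))).symm
  have e1 := integral_map (μ := P) h1.aemeasurable hg.aestronglyMeasurable
  have e2 := integral_map (μ := P) h2.aemeasurable hg.aestronglyMeasurable
  rw [← e1, hmap, e2]

theorem ae_chosen_mem (hX : X.IsCombLinTS P Φ lam σ oracle n) :
    ∀ᵐ ω ∂P, ∀ t < n, X.chosen t ω ∈ 𝒜 := by
  rw [ae_all_iff]
  intro t
  by_cases ht : t < n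
  swap
  · simp [ht]
  have hs : MeasurableSet {A : Finset (Fin L) | A ∉ 𝒜} := MeasurableSet.of_discrete
  have h := hX.lintegral_play ht (Y := fun _ => ()) measurable_const
    (G := fun p => Set.indicator {A : Finset (Fin L) | A ∉ 𝒜} 1 p.2.2)
    ((measurable_one.indicator hs).comp (by fun_prop))
  have h0 : ∀ b, ∫⁻ x, Set.indicator {A : Finset (Fin L) | A ∉ 𝒜} (1 : Finset (Fin L) → ENNReal) x.2
      ∂oracle.playKernel Φ b = 0 := by
    intro b
    rw [lintegral_playKernel oracle Φ b
      (g := fun x => Set.indicator {A : Finset (Fin L) | A ∉ 𝒜} 1 x.2)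
      ((measurable_one.indicator hs).comp measurable_snd)]
    have : ∀ θ, ∫⁻ A, Set.indicator {A : Finset (Fin L) | A ∉ 𝒜} (1 : Finset (Fin L) → ENNReal) A
        ∂oracle.linKernel Φ θ = 0 := fun θ => by
      rw [lintegral_indicator_one hs]
      exact ae_iff.1 (ae_mem_linKernel oracle Φ θ)
    simp [this]
  simp only [h0, lintegral_zero] at h
  rw [lintegral_eq_zero_iff (f := fun ω => Set.indicator {A : Finset (Fin L) | A ∉ 𝒜} 1
    (X.chosen t ω)) ((measurable_one.indicator hs).comp (hX.measurable_chosen t ht))] at h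
  filter_upwards [h] with ω hω _
  by_contra hn
  simp [hn] at hω

/-- The regret of one episode, for a confidence parameter `c` that is exceeded by `ε` at most. -/
theorem integral_regret_le (hX : X.IsCombLinTS P Φ lam σ oracle n) (hlam : 0 < lam) (hσ : 0 < σ)
    (hΦ : ∀ e, ‖feature Φ e‖ ≤ 1) {t : ℕ} (ht : t < n) (c : ℝ) {ε : ℝ} (hε : 0 ≤ ε)
    (hexc : ∀ ω, ∫⁻ x, ENNReal.ofReal (excess Φ c (X.beliefAt Φ lam σ t ω) x)
      ∂oracle.playKernel Φ (X.beliefAt Φ lam σ t ω) ≤ ENNReal.ofReal ε) :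
    Integrable (X.regret t) P ∧ ∫ ω, X.regret t ω ∂P ≤
      ε + c * ∫ ω, ∑ e ∈ X.chosen t ω, width Φ (X.beliefAt Φ lam σ t ω) e ∂P := by
  have hAm := hX.measurable_chosen t ht
  have hOm := hX.measurable_optSet
  have hw := hX.integrable_width hlam hσ hΦ ht.le
  have hdev := hX.integrable_deviation hlam hσ hΦ ht.le
  have hmean := hX.integrable_dotProduct_mean hlam hσ hΦ ht.le
  have hnoise := hX.integrable_noise ht
  set b := X.beliefAt Φ lam σ t with hb
  set T : Ω → ℝ := fun ω => excess Φ c (b ω) (X.thetaStar ω, X.optSet ω) with hT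
  -- The sum of the upper confidence bounds over a set. It sees only the belief and the set, so `A*`
  -- and `A^t` give it the same expectation.
  let g : Belief d × Finset (Fin L) → ℝ :=
    fun p => ∑ e ∈ p.2, (Φ e ⬝ᵥ p.1.mean + c * width Φ p.1 e)
  have hgm : Measurable g := by
    refine measurable_sum_mem (A := fun p : Belief d × Finset (Fin L) => p.2) measurable_snd
      (h := fun e p => Φ e ⬝ᵥ p.1.mean + c * width Φ p.1 e) fun e => ?_
    have h1 := measurable_belief_mean (d := d)
    have h2 := measurable_width (d := d) Φ e
    fun_prop
  have hTi : Integrable T P :=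
    integrable_sum_mem hOm fun e => (hdev e).sub ((hw e).const_mul c)
  have hg1 : Integrable (fun ω => g (b ω, X.optSet ω)) P :=
    integrable_sum_mem hOm fun e => (hmean e).add ((hw e).const_mul c)
  have hg2 : Integrable (fun ω => g (b ω, X.chosen t ω)) P :=
    integrable_sum_mem hAm fun e => (hmean e).add ((hw e).const_mul c)
  have hD : Integrable (fun ω => ∑ e ∈ X.chosen t ω,
      Φ e ⬝ᵥ ((X.thetaStar ω).ofLp - (b ω).mean)) P := integrable_sum_mem hAm hdev
  have hW : Integrable (fun ω => ∑ e ∈ X.chosen t ω, width Φ (b ω) e) P :=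
    integrable_sum_mem hAm hw
  have hN1 : Integrable (fun ω => ∑ e ∈ X.optSet ω, X.noise Φ t ω e) P :=
    integrable_sum_mem hOm hnoise
  have hN2 : Integrable (fun ω => ∑ e ∈ X.chosen t ω, X.noise Φ t ω e) P :=
    integrable_sum_mem hAm hnoise
  have hdecomp : X.regret t = fun ω => T ω + (g (b ω, X.optSet ω) - g (b ω, X.chosen t ω)) +
      (c * ∑ e ∈ X.chosen t ω, width Φ (b ω) e -
        ∑ e ∈ X.chosen t ω, Φ e ⬝ᵥ ((X.thetaStar ω).ofLp - (b ω).mean)) +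
      (∑ e ∈ X.optSet ω, X.noise Φ t ω e - ∑ e ∈ X.chosen t ω, X.noise Φ t ω e) := by
    funext ω
    have hweight : ∀ e, X.weight t ω e = Φ e ⬝ᵥ (X.thetaStar ω).ofLp + X.noise Φ t ω e := by
      intro e
      simp [Run.noise, linWeight_apply]
    simp only [Run.regret, totalWeight, hweight, hT, excess, g, Finset.sum_add_distrib,
      Finset.sum_sub_distrib, dotProduct_sub, Finset.mul_sum]
    ring
  have hg12 : Integrable (fun ω => g (b ω, X.optSet ω) - g (b ω, X.chosen t ω)) P := hg1.sub hg2
  have hi12 : Integrable (fun ω => T ω + (g (b ω, X.optSet ω) - g (b ω, X.chosen t ω))) P :=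
    hTi.add hg12
  have hi3 : Integrable (fun ω => c * ∑ e ∈ X.chosen t ω, width Φ (b ω) e -
      ∑ e ∈ X.chosen t ω, Φ e ⬝ᵥ ((X.thetaStar ω).ofLp - (b ω).mean)) P :=
    (hW.const_mul c).sub hD
  have hi123 : Integrable (fun ω => T ω + (g (b ω, X.optSet ω) - g (b ω, X.chosen t ω)) +
      (c * ∑ e ∈ X.chosen t ω, width Φ (b ω) e -
        ∑ e ∈ X.chosen t ω, Φ e ⬝ᵥ ((X.thetaStar ω).ofLp - (b ω).mean))) P := hi12.add hi3
  have hi4 : Integrable (fun ω => ∑ e ∈ X.optSet ω, X.noise Φ t ω e -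
      ∑ e ∈ X.chosen t ω, X.noise Φ t ω e) P := hN1.sub hN2
  have hint : ∫ ω, X.regret t ω ∂P = ∫ ω, T ω ∂P +
      (∫ ω, g (b ω, X.optSet ω) ∂P - ∫ ω, g (b ω, X.chosen t ω) ∂P) +
      (c * ∫ ω, ∑ e ∈ X.chosen t ω, width Φ (b ω) e ∂P -
        ∫ ω, ∑ e ∈ X.chosen t ω, Φ e ⬝ᵥ ((X.thetaStar ω).ofLp - (b ω).mean) ∂P) +
      (∫ ω, ∑ e ∈ X.optSet ω, X.noise Φ t ω e ∂P -
        ∫ ω, ∑ e ∈ X.chosen t ω, X.noise Φ t ω e ∂P) := by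
    rw [← integral_const_mul, ← integral_sub hN1 hN2, ← integral_sub hg1 hg2,
      ← integral_sub (hW.const_mul c) hD, ← integral_add hTi hg12,
      ← integral_add hi12 hi3, ← integral_add hi123 hi4, hdecomp]
  refine ⟨by rw [hdecomp]; exact hi123.add hi4, ?_⟩
  have hz1 := hX.integral_optSet_eq_integral_chosen hlam hσ ht hgm
  have hz2 := hX.integral_sum_deviation_eq_zero hlam hσ ht
  -- The two projections select `A*` and `A^t`, both determined before the noise of the episode.
  have hz3 := hX.integral_sum_noise_eq_zero ht (X.measurable_optSet_past t) measurable_fst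
  have hz4 := hX.integral_sum_noise_eq_zero ht (X.measurable_optSet_past t) measurable_snd
  have hTle : ∫ ω, T ω ∂P ≤ ε := by
    refine integral_le_of_lintegral_ofReal_le hTi hε ?_
    refine (hX.lintegral_posterior hlam hσ ht.le
      (G := fun p => ENNReal.ofReal (excess Φ c p.2 p.1))
      ((measurable_excess Φ c).comp measurable_swap).ennreal_ofReal).le.trans ?_
    refine (lintegral_mono hexc).trans ?_
    simp
  simp only at hz3 hz4
  rw [hint, hz1, hz2, hz3, hz4]
  linarith

theorem bayesRegret_le (hX : X.IsCombLinTS P Φ lam σ oracle n) (hlam : 0 < lam) (hσ : 0 < σ)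
    (hΦ : ∀ e, ‖feature Φ e‖ ≤ 1) {K : ℕ} (hK : ∀ A ∈ 𝒜, A.card ≤ K) {c : ℝ} (hc : 0 ≤ c) {ε : ℝ}
    (hε : 0 ≤ ε) (hexc : ∀ t ω, ∫⁻ x, ENNReal.ofReal (excess Φ c (X.beliefAt Φ lam σ t ω) x)
      ∂oracle.playKernel Φ (X.beliefAt Φ lam σ t ω) ≤ ENNReal.ofReal ε) :
    X.bayesRegret P n ≤ n * ε + c * (K * lam *
      √(d * n * Real.log (1 + n * K * lam ^ 2 / (d * σ ^ 2)) /
        Real.log (1 + lam ^ 2 / σ ^ 2))) := by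
  have hWi : ∀ t ∈ Finset.range n, Integrable (fun ω =>
      ∑ e ∈ X.chosen t ω, width Φ (X.beliefAt Φ lam σ t ω) e) P := fun t ht =>
    integrable_sum_mem (hX.measurable_chosen t (Finset.mem_range.1 ht))
      (hX.integrable_width hlam hσ hΦ (Finset.mem_range.1 ht).le)
  calc X.bayesRegret P n
      ≤ ∑ t ∈ Finset.range n,
        (ε + c * ∫ ω, ∑ e ∈ X.chosen t ω, width Φ (X.beliefAt Φ lam σ t ω) e ∂P) :=
        Finset.sum_le_sum fun t ht =>
          (hX.integral_regret_le hlam hσ hΦ (Finset.mem_range.1 ht) c hε (hexc t)).2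
    _ = n * ε + c * ∫ ω, ∑ t ∈ Finset.range n,
        ∑ e ∈ X.chosen t ω, width Φ (X.beliefAt Φ lam σ t ω) e ∂P := by
        rw [Finset.sum_add_distrib, Finset.sum_const, Finset.card_range, nsmul_eq_mul,
          ← Finset.mul_sum, integral_finsetSum _ hWi]
    _ ≤ _ := by
        gcongr
        set W := K * lam * √(d * n * Real.log (1 + n * K * lam ^ 2 / (d * σ ^ 2)) /
          Real.log (1 + lam ^ 2 / σ ^ 2))
        calc _ ≤ ∫ _ω, W ∂P := by
              refine integral_mono_ae (integrable_finsetSum _ hWi) (integrable_const _) ?_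
              filter_upwards [hX.ae_chosen_mem] with ω hω
              -- The width bound holds along each path on which all chosen sets are feasible, so it
              -- needs no expectation.
              have := sum_sqrt_quadForm_le Φ (fun s => X.chosen s ω) hlam hσ hΦ
                (K := K) (n := n) fun t ht => hK _ (hω t ht)
              simpa only [width, beliefAt, belief_cov Φ _ hlam hσ] using this
          _ = W := by simp

end Run.IsCombLinTS

/-! ### Choice of the confidence level and conclusion. -/

theorem mul_exp_neg_le_one {x y : ℝ} (hx : 0 ≤ x) (h : Real.log x ≤ y) : x * Real.exp (-y) ≤ 1 := by
  rcases hx.eq_or_lt with rfl | hx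
  · simp
  · rw [← Real.exp_log hx, ← Real.exp_add]
    exact Real.exp_le_one_iff.2 (by linarith)

/-- Negative `y` matters: when the logarithm in the bound is negative the level `c` is `0`, and this
is still enough. -/
theorem le_sqrt_sq (y : ℝ) : y ≤ √y ^ 2 := by
  rcases le_total 0 y with h | h
  · rw [Real.sq_sqrt h]
  · exact h.trans (sq_nonneg _)

end CombLinTS

theorem theorem3 {L d : ℕ} (K n : ℕ) (𝒜 : Finset (Finset (Fin L)))
    (hK : ∀ A ∈ 𝒜, A.card ≤ K)
    (Φ : Matrix (Fin L) (Fin d) ℝ) (hΦ : ∀ e, ‖CombLinTS.feature Φ e‖ ≤ 1)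
    (lam σ : ℝ) (hlam : 0 < lam) (hσ : 0 < σ)
    (oracle : CombLinTS.Oracle L 𝒜)
    {Ω : Type*} [MeasurableSpace Ω] (P : Measure Ω) [IsProbabilityMeasure P]
    (X : CombLinTS.Run Ω L d) (hX : X.IsCombLinTS P Φ lam σ oracle n) :
    (∀ t < n, Integrable (X.regret t) P) ∧
    X.bayesRegret P n ≤
      1 + K * lam
        * min (Real.sqrt (Real.log (lam * L * n / Real.sqrt (2 * Real.pi))))
            (Real.sqrt (d * Real.log (2 * d * K * n * lam / Real.sqrt (2 * Real.pi))))
        * Real.sqrt (2 * d * n * Real.log (1 + n * K * lam ^ 2 / (d * σ ^ 2))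
            / Real.log (1 + lam ^ 2 / σ ^ 2)) := by
  have hwidth := X.width_beliefAt_le hlam hσ hΦ
  have hcov := X.posDef_beliefAt_cov Φ hlam hσ
  -- The overshoots of `n` episodes total `x₁ exp (-c² / 2)` in the first bound and `x₂ exp (-c² /
  -- (2 d))` in the second (for `d > 0`). The levels `c² = 2 log x₁` and `c² = 2 d log x₂` bring
  -- these down to 1.
  set x₁ : ℝ := lam * L * n / √(2 * Real.pi) with hx₁
  set x₂ : ℝ := 2 * d * K * n * lam / √(2 * Real.pi) with hx₂
  have hexc₁ := fun t ω => CombLinTS.lintegral_excess_le_card oracle Φ (hcov t ω)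
    (Real.sqrt_nonneg (2 * Real.log x₁)) (hwidth t ω)
  have hexc₂ := fun t ω => CombLinTS.lintegral_excess_le_dim oracle hK Φ (hcov t ω) hlam.le
    (Real.sqrt_nonneg (2 * (d * Real.log x₂))) (hwidth t ω)
  have hr₁ := hX.bayesRegret_le hlam hσ hΦ hK (Real.sqrt_nonneg (2 * Real.log x₁))
    (by positivity) hexc₁
  have hr₂ := hX.bayesRegret_le hlam hσ hΦ hK (Real.sqrt_nonneg (2 * (d * Real.log x₂)))
    (by positivity) hexc₂
  refine ⟨fun t ht => (hX.integral_regret_le hlam hσ hΦ ht _ (by positivity) (hexc₁ t)).1, ?_⟩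
  have hε₁ : n * (L * lam * (Real.exp (-√(2 * Real.log x₁) ^ 2 / 2) / √(2 * Real.pi))) ≤ 1 := by
    have h := CombLinTS.mul_exp_neg_le_one (x := x₁) (y := √(2 * Real.log x₁) ^ 2 / 2)
      (by positivity) (by linarith [CombLinTS.le_sqrt_sq (2 * Real.log x₁)])
    refine le_trans (le_of_eq ?_) h
    rw [neg_div]
    generalize √(2 * Real.log x₁) ^ 2 / 2 = y
    rw [hx₁]
    ring
  have hε₂ : n * (K * lam * (2 * d *
      (Real.exp (-√(2 * (d * Real.log x₂)) ^ 2 / (2 * d)) / √(2 * Real.pi)))) ≤ 1 := by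
    rcases Nat.eq_zero_or_pos d with rfl | hd
    · simp
    have hd' : (0 : ℝ) < d := by exact_mod_cast hd
    have h := CombLinTS.mul_exp_neg_le_one (x := x₂)
      (y := √(2 * (d * Real.log x₂)) ^ 2 / (2 * d)) (by positivity)
      (by
        rw [le_div_iff₀ (by positivity)]
        linarith [CombLinTS.le_sqrt_sq (2 * (d * Real.log x₂))])
    refine le_trans (le_of_eq ?_) h
    rw [neg_div]
    generalize √(2 * (d * Real.log x₂)) ^ 2 / (2 * d) = y
    rw [hx₂]
    ring
  set W : ℝ := d * n * Real.log (1 + n * K * lam ^ 2 / (d * σ ^ 2)) /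
    Real.log (1 + lam ^ 2 / σ ^ 2) with hW
  have hWeq : √(2 * d * n * Real.log (1 + n * K * lam ^ 2 / (d * σ ^ 2)) /
      Real.log (1 + lam ^ 2 / σ ^ 2)) = √2 * √W := by
    rw [← Real.sqrt_mul (by norm_num), hW]
    congr 1
    ring
  have hc : ∀ y : ℝ, √(2 * y) * (K * lam * √W) = K * lam * √y * (√2 * √W) := fun y => by
    rw [Real.sqrt_mul (by norm_num)]
    ring
  rw [hc] at hr₁ hr₂
  rw [hWeq]
  -- Both bounds hold for the same run, so whichever attains the minimum applies.
  rcases min_choice √(Real.log x₁) √(d * Real.log x₂) with h | h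
  · rw [h]
    linarith
  · rw [h]
    linarith
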